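/- **Setting.** Let $d\ge 0$, $N\ge1$. For finite $X\subset\mathbb Z^d$ let $\mathcal A_X$ be the algebra of operators on $\bigotimes_{x\in X}\mathbb C^N$, with operator norm $\|\cdot\|$ and normalized trace $\operatorname{tr}$ (so $\operatorname{tr} 1=1$). For $X\subset\Lambda$ identify $A\in\mathcal A_X$ with $A\otimes 1\in\mathcal A_\Lambda$. An interaction is a family $\Phi=(\Phi_X)$ with $\Phi_X\in\mathcal A_X$ for every finite $X\subset\mathbb Z^d$; put $$\|\Phi\|_r=\sup_{x\in\mathbb Z^d}\sum_{X\ni x}\|\Phi_X\|\,r^{|X|}\in[0,\infty],\qquad H_\Lambda=\sum_{X\subset\Lambda}\Phi_X,\qquad Z_\Lambda(\beta)=\operatorname{tr} e^{-\beta H_\Lambda}.$$ For finite $\Lambda\subset\mathbb Z^d$ let $\mathcal C_\Lambda$ be the set of clusters in $\Lambda$: sequences $C=(X_1,\dots,X_n)$, $n\ge1$, of subsets of $\Lambda$ such that the graph on $\{1,\dots,n\}$ with edges $\{i,j\}$, $i\ne j$, $X_i\cap X_j\neq\emptyset$, is connected. Put $\operatorname{supp}C=\bigcup_iX_i$ and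 $$w(C)=\frac{(-\beta)^n}{n!}\operatorname{tr}\,\Phi_{X_1}\cdots\Phi_{X_n},\qquad \varphi(C_1,\dots,C_k)=\sum_{g}\ \prod_{\{i,j\}\in g}\bigl(-1_{\operatorname{supp}C_i\cap\operatorname{supp}C_j\ne\emptyset}\bigr),$$ where $g$ runs over the connected graphs with vertices $1,\dots,k$ (so $\varphi(C_1)=1$). **Theorem 3.1.** Let $a>0$. (1) Let $\beta\in\mathbb C$ satisfy $|\beta|\,\|\Phi\|_{e^a(1+a)}\le a$ (with $0\cdot\infty=0$); this includes all real inverse temperatures $\beta\ge0$ with $\beta\|\Phi\|_{e^a(1+a)}\le a$. Then for every finite $\Lambda\subset\mathbb Z^d$ $$Z_\Lambda(\beta)=\exp\Bigl\{\sum_{k\ge1}\frac1{k!}\sum_{C_1,\dots,C_k\in\mathcal C_\Lambda}\varphi(C_1,\dots,C_k)\prod_{i=1}^kw(C_i)\Bigr\},$$ the sum over $k$ and $C_1,\dots,C_k$ being absolutely convergent, and for every $C_1\in\mathcal C_\Lambda$ $$1+\sum_{k\ge2}\frac{k}{k!}\sum_{C_2,\dots,C_k\in\mathcal C_\Lambda}\bigl|\varphi(C_1,\dots,C_k)\bigr|\prod_{i=2}^k|w(C_i)|\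 \le\ e^{a|\operatorname{supp}C_1|}.$$ (2) Let $D=\{\beta\in\mathbb C:|\beta|\,\|\Phi\|_{e^a(1+a)}<a\}$. For every finite nonempty $\Lambda\subset\mathbb Z^d$ there is a function $f_\Lambda$ (the free energy $-\frac1{|\Lambda|}\log Z_\Lambda$), analytic at every point of $D$, with $f_\Lambda(0)=0$ and $Z_\Lambda(\beta)=e^{-|\Lambda|f_\Lambda(\beta)}$ for all $\beta\in D$. These functions have the following property. If $(\Lambda_m)$ is a sequence of finite sets increasing to $\mathbb Z^d$ (every finite set is contained in $\Lambda_m$ for all large $m$) and $f_{\Lambda_m}(t)\to g(t)$ for every real $t\ge0$ in $D$, then there is a function $G$, analytic at every point of $D$, with $G(t)=g(t)$ for all real $t\ge0$ in $D$. -/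

import Mathlib

open scoped ENNReal Nat
open Filter Topology

namespace QLattice

/-- The sites of the simple cubic lattice of dimension `d`. -/
abbrev Site (d : ℕ) : Type := Fin d → ℤ

/-- Spin configurations on `X`. They label the product basis of the Hilbert space of `X`,
the tensor product over the sites `x ∈ X` of copies of `ℂ ^ N`. -/
abbrev Config {d : ℕ} (N : ℕ) (X : Finset (Site d)) : Type := X → Fin N

/-- The algebra of all operators on the Hilbert space of `X`, i.e. the tensor product over `x ∈ X`
of copies of the algebra of `N × N` matrices, written in the product basis. -/
abbrev LocalAlg {d : ℕ} (N : ℕ) (X : Finset (Site d)) : Type :=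
  Matrix (Config N X) (Config N X) ℂ

/-- The operator norm (with respect to the Hilbert space norm), in `[0, ∞]`. -/
noncomputable def opNorm {d N : ℕ} {X : Finset (Site d)} (A : LocalAlg N X) : ℝ≥0∞ :=
  ‖Matrix.toEuclideanCLM (n := Config N X) (𝕜 := ℂ) A‖ₑ

/-- The normalized trace. -/
noncomputable def ntr {d N : ℕ} {X : Finset (Site d)} (A : LocalAlg N X) : ℂ :=
  A.trace / (Fintype.card (Config N X) : ℂ)

/-- For `X ⊆ Λ`, the identification of `A` in the algebra of `X` with `A ⊗ 1` in the algebra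
of `Λ`, where `1` is the identity on the sites of `Λ` outside `X`. -/
def embed {d N : ℕ} {X Λ : Finset (Site d)} (h : X ⊆ Λ) (A : LocalAlg N X) : LocalAlg N Λ :=
  Matrix.of fun σ τ =>
    if ∀ x : Λ, x.1 ∉ X → σ x = τ x then
      A (fun x => σ ⟨x.1, h x.2⟩) (fun x => τ ⟨x.1, h x.2⟩)
    else 0

/-- An interaction: an operator in the algebra of `X`, for every finite set of sites `X`. -/
abbrev Interaction (d N : ℕ) : Type := (X : Finset (Site d)) → LocalAlg N X

/-- The norm `sup_x ∑_{X ∋ x} ‖Φ_X‖ r ^ |X|` of an interaction, possibly infinite. -/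
noncomputable def interactionNorm {d N : ℕ} (Φ : Interaction d N) (r : ℝ) : ℝ≥0∞ :=
  ⨆ x : Site d, ∑' X : {X : Finset (Site d) // x ∈ X},
    opNorm (Φ X.1) * ENNReal.ofReal r ^ X.1.card

/-- The interaction term of `X ⊆ Λ` as an operator on the Hilbert space of `Λ`. -/
def term {d N : ℕ} (Φ : Interaction d N) {Λ : Finset (Site d)} (X : Λ.powerset) : LocalAlg N Λ :=
  embed (Finset.mem_powerset.1 X.2) (Φ X.1)

/-- The Hamiltonian `H_Λ = ∑_{X ⊆ Λ} Φ_X`. -/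
def hamiltonian {d N : ℕ} (Φ : Interaction d N) (Λ : Finset (Site d)) : LocalAlg N Λ :=
  ∑ X : Λ.powerset, term Φ X

/-- The partition function `Z_Λ = tr exp (-β H_Λ)`, with the normalized trace. -/
noncomputable def partitionFunction {d N : ℕ} (Φ : Interaction d N) (Λ : Finset (Site d))
    (β : ℂ) : ℂ :=
  ntr (NormedSpace.exp (-β • hamiltonian Φ Λ))

/-- The graph on the positions of a sequence `(X_1, …, X_n)` of finite sets: two distinct positions
are joined if the corresponding sets intersect. -/
def overlapGraph {d n : ℕ} (X : Fin n → Finset (Site d)) : SimpleGraph (Fin n) where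
  Adj i j := i ≠ j ∧ (X i ∩ X j).Nonempty
  symm := ⟨fun i j h => ⟨h.1.symm, by rw [Finset.inter_comm]; exact h.2⟩⟩
  loopless := ⟨fun _ h => h.1 rfl⟩

/-- Clusters in `Λ`: finite sequences `(X_1, …, X_n)` of subsets of `Λ` whose overlap graph is
connected. Since a connected graph has a vertex, `n ≥ 1`. -/
structure Cluster {d : ℕ} (Λ : Finset (Site d)) where
  /-- The number of sets in the sequence. -/
  n : ℕ
  /-- The sets of the sequence. -/
  X : Fin n → Λ.powerset
  connected : (overlapGraph fun i => (X i).1).Connected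

/-- The support of a cluster: the union of its sets. -/
def Cluster.supp {d : ℕ} {Λ : Finset (Site d)} (C : Cluster Λ) : Finset (Site d) :=
  Finset.univ.biUnion fun i => (C.X i).1

/-- The weight `w(C) = (-β) ^ n / n! * tr (Φ_{X_1} ⋯ Φ_{X_n})` of `C = (X_1, …, X_n)`. -/
noncomputable def weight {d N : ℕ} (Φ : Interaction d N) (β : ℂ) {Λ : Finset (Site d)}
    (C : Cluster Λ) : ℂ :=
  (-β) ^ C.n / (C.n ! : ℂ) * ntr (List.ofFn fun i => term Φ (C.X i)).prod

open scoped Classical in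
/-- The combinatorial function `φ(C_1, …, C_k)`: the sum over all connected graphs `g` with vertices
`1, …, k` of the product over the edges `{i, j}` of `g` of `-1` or `0`, according to whether the
supports of `C_i` and `C_j` intersect or not. For `k = 1` this is the empty product `1`. -/
noncomputable def phi {d : ℕ} {Λ : Finset (Site d)} {k : ℕ} (C : Fin k → Cluster Λ) : ℤ :=
  ∑ g : SimpleGraph (Fin k) with g.Connected,
    ∏ e : Fin k × Fin k with e.1 < e.2 ∧ g.Adj e.1 e.2,
      if ((C e.1).supp ∩ (C e.2).supp).Nonempty then -1 else 0

/-- The term of `(C_1, …, C_k)` in the cluster expansion, without the factor `1 / k!`. -/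
noncomputable def clusterTerm {d N : ℕ} (Φ : Interaction d N) (β : ℂ) {Λ : Finset (Site d)}
    {k : ℕ} (C : Fin k → Cluster Λ) : ℂ :=
  (phi C : ℂ) * ∏ i, weight Φ β (C i)

/-- The disc of complex `β` with `|β| ‖Φ‖_r < a`, where `r = e ^ a (1 + a)`. -/
def highTempDisc {d N : ℕ} (Φ : Interaction d N) (a : ℝ) : Set ℂ :=
  {β | ‖β‖ₑ * interactionNorm Φ (Real.exp a * (1 + a)) < ENNReal.ofReal a}

end QLattice

/-!
Expanding the exponential turns `Z_Λ` into a series over sequences `X₁, …, Xₙ ⊆ Λ` weighted by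
`tr Φ_{X₁} ⋯ Φ_{Xₙ}`. The trace factorizes over terms with disjoint supports, so splitting off the
connected component of a site `x` gives `Z(A) = Z(A \ x) + ∑_{U ∋ x} ω(U) Z(A \ U)`, where `ω(U)`
is the total weight of the clusters with support `U`. The partition function of the gas of hard-core
polymers with activities `ω` obeys the same recursion, hence the two coincide.

The logarithm of that gas is its Mayer series: exploring a connected graph from a root gives a
recursion for the Ursell functions, which for generating functions reads `B' = A' B`. Since
`|1 + ζ| ≤ 1` for the Mayer function `ζ`, the series of absolute values is dominated by every
supersolution of the tree fixed-point equation, and the Kotecký–Preiss bound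
`∑_{U ∋ x} |ω(U)| e ^ (a |U|) ≤ a` supplies one. This bound in turn follows by exploring a cluster
site by site, at the price of a factor `1 + a` per site, because `exp (a / (1 + a)) ≤ 1 + a`.

All of this is uniform in the disc of the inverse temperatures, so the free energies are a bounded
family of power series, and a limit of their coefficients along an ultrafilter is the series of `G`.
-/

open scoped NNReal

namespace ClusterExpansion

/-- The sum of `H A B` over all ways to split the list `l` into a subsequence `A` and the
complementary subsequence `B`. -/
def splitSum {α M : Type*} [AddCommMonoid M] : List α → (List α → List α → M) → M
  | [], H => H [] []
  | a :: l, H => splitSum l (fun A B => H (a :: A) B) + splitSum l (fun A B => H A (a :: B))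

/-- The sum of `f l` over all lists `l` of length `n` with entries in `F`. -/
def listSum {α M : Type*} [AddCommMonoid M] (F : Finset α) : ℕ → (List α → M) → M
  | 0, f => f []
  | n + 1, f => ∑ a ∈ F, listSum F n (fun l => f (a :: l))

section SplitSum

variable {α β M R : Type*} [AddCommMonoid M] [Semiring R]

theorem splitSum_congr {l : List α} {H H' : List α → List α → M}
    (h : ∀ A B, (A ++ B).Perm l → H A B = H' A B) : splitSum l H = splitSum l H' := by
  induction l generalizing H H' with
  | nil => exact h [] [] (by simp)
  | cons a l ih =>
    exact congrArg₂ (· + ·) (ih fun A B hAB => h _ _ (by simpa using hAB))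
      (ih fun A B hAB => h _ _ (List.perm_middle.trans (hAB.cons a)))

theorem splitSum_zero (l : List α) : splitSum l (fun _ _ => (0 : M)) = 0 := by
  induction l with
  | nil => rfl
  | cons a l ih => simp only [splitSum, ih, add_zero]

theorem splitSum_add (l : List α) (H H' : List α → List α → M) :
    splitSum l (fun A B => H A B + H' A B) = splitSum l H + splitSum l H' := by
  induction l generalizing H H' with
  | nil => rfl
  | cons a l ih => simp only [splitSum, ih]; abel

theorem splitSum_sum {ι : Type*} (s : Finset ι) (l : List α) (H : ι → List α → List α → M) :
    splitSum l (fun A B => ∑ i ∈ s, H i A B) = ∑ i ∈ s, splitSum l (H i) := by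
  induction l generalizing H with
  | nil => rfl
  | cons a l ih => simp only [splitSum, ih, Finset.sum_add_distrib]

theorem map_splitSum {N : Type*} [AddCommMonoid N] (ψ : M →+ N) (l : List α)
    (H : List α → List α → M) : ψ (splitSum l H) = splitSum l (fun A B => ψ (H A B)) := by
  induction l generalizing H with
  | nil => rfl
  | cons a l ih => simp only [splitSum, map_add, ih]

theorem splitSum_mul_left (c : R) (l : List α) (H : List α → List α → R) :
    splitSum l (fun A B => c * H A B) = c * splitSum l H :=
  (map_splitSum (AddMonoidHom.mulLeft c) l H).symm

theorem splitSum_mul_right (c : R) (l : List α) (H : List α → List α → R) :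
    splitSum l (fun A B => H A B * c) = splitSum l H * c :=
  (map_splitSum (AddMonoidHom.mulRight c) l H).symm

theorem splitSum_list_map (g : α → β) (l : List α) (H : List β → List β → M) :
    splitSum (l.map g) H = splitSum l (fun A B => H (A.map g) (B.map g)) := by
  induction l generalizing H with
  | nil => rfl
  | cons a l ih => simp only [List.map_cons, splitSum, ih]

theorem natAbs_splitSum_le (l : List α) (H : List α → List α → ℤ) :
    (splitSum l H).natAbs ≤ splitSum l (fun A B => (H A B).natAbs) := by
  induction l generalizing H with
  | nil => exact le_rfl
  | cons a l ih => exact (Int.natAbs_add_le _ _).trans (add_le_add (ih _) (ih _))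

theorem splitSum_ite_filter (p : α → Prop) [DecidablePred p] (l : List α)
    (H : List α → List α → M) :
    splitSum l (fun A B => if (∀ a ∈ A, p a) ∧ (∀ b ∈ B, ¬ p b) then H A B else 0) =
      H (l.filter p) (l.filter (fun a => ¬ p a)) := by
  induction l generalizing H with
  | nil => simp [splitSum]
  | cons a l ih =>
    by_cases ha : p a
    · have := ih fun A B => H (a :: A) B
      simp_all [splitSum, splitSum_zero]
    · have := ih fun A B => H A (a :: B)
      simp_all [splitSum, splitSum_zero]

theorem splitSum_eq_nil_left (l : List α) {H : List α → List α → M}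
    (h : ∀ a A B, H (a :: A) B = 0) : splitSum l H = H [] l := by
  induction l generalizing H with
  | nil => rfl
  | cons a l ih =>
    simp only [splitSum, h, splitSum_zero, zero_add]
    exact ih fun _ _ _ => h _ _ _

theorem splitSum_assoc (l : List α) (H : List α → List α → List α → M) :
    splitSum l (fun AB C => splitSum AB (fun A B => H A B C)) =
      splitSum l (fun A BC => splitSum BC (fun B C => H A B C)) := by
  induction l generalizing H with
  | nil => rfl
  | cons a l ih =>
    simp only [splitSum, splitSum_add]
    rw [ih (fun A B C => H (a :: A) B C), ih (fun A B C => H A (a :: B) C),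
      ih (fun A B C => H A B (a :: C)), add_assoc]

theorem prod_one_add_eq_splitSum {S : Type*} [CommSemiring S] (f : α → S) (l : List α) :
    (l.map fun a => 1 + f a).prod = splitSum l (fun A _ => (A.map f).prod) := by
  induction l with
  | nil => rfl
  | cons a l ih =>
    simp only [splitSum, List.map_cons, List.prod_cons, splitSum_mul_left, ← ih]
    ring

end SplitSum

section ListSum

open Finset.HasAntidiagonal (antidiagonal mem_antidiagonal)

variable {α M R : Type*} [AddCommMonoid M] [Semiring R] (F : Finset α) (n : ℕ)

theorem listSum_congr {F : Finset α} {n : ℕ} {f g : List α → M}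
    (h : ∀ l : List α, l.length = n → (∀ a ∈ l, a ∈ F) → f l = g l) :
    listSum F n f = listSum F n g := by
  induction n generalizing f g with
  | zero => exact h [] rfl (by simp)
  | succ n ih =>
    refine Finset.sum_congr rfl fun a ha => ih fun l hl hlF => h _ (by simp [hl]) ?_
    simpa using ⟨ha, hlF⟩

theorem listSum_zero : listSum F n (fun _ => (0 : M)) = 0 := by
  induction n with
  | zero => rfl
  | succ n ih => simp only [listSum, ih, Finset.sum_const_zero]

theorem listSum_add (f g : List α → M) :
    listSum F n (fun l => f l + g l) = listSum F n f + listSum F n g := by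
  induction n generalizing f g with
  | zero => rfl
  | succ n ih => simp only [listSum, ih, Finset.sum_add_distrib]

theorem map_listSum {N : Type*} [AddCommMonoid N] (ψ : M →+ N) (f : List α → M) :
    ψ (listSum F n f) = listSum F n (fun l => ψ (f l)) := by
  induction n generalizing f with
  | zero => rfl
  | succ n ih => simp only [listSum, map_sum, ih]

theorem listSum_mul_left (c : R) (f : List α → R) :
    listSum F n (fun l => c * f l) = c * listSum F n f :=
  (map_listSum F n (AddMonoidHom.mulLeft c) f).symm

theorem listSum_mul_right (c : R) (f : List α → R) :
    listSum F n (fun l => f l * c) = listSum F n f * c :=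
  (map_listSum F n (AddMonoidHom.mulRight c) f).symm

theorem listSum_sum {ι : Type*} (s : Finset ι) (f : ι → List α → M) :
    listSum F n (fun l => ∑ i ∈ s, f i l) = ∑ i ∈ s, listSum F n (f i) := by
  induction n generalizing f with
  | zero => rfl
  | succ n ih => simp only [listSum, ih]; exact Finset.sum_comm

theorem listSum_mono [PartialOrder M] [IsOrderedAddMonoid M] {F : Finset α} {n : ℕ}
    {f g : List α → M} (h : ∀ l : List α, l.length = n → (∀ a ∈ l, a ∈ F) → f l ≤ g l) :
    listSum F n f ≤ listSum F n g := by
  induction n generalizing f g with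
  | zero => exact h [] rfl (by simp)
  | succ n ih =>
    refine Finset.sum_le_sum fun a ha => ih fun l hl hlF => h _ (by simp [hl]) ?_
    simpa using ⟨ha, hlF⟩

theorem nnnorm_listSum_le {E : Type*} [SeminormedAddCommGroup E] (f : List α → E) :
    ‖listSum F n f‖₊ ≤ listSum F n (fun l => ‖f l‖₊) := by
  induction n generalizing f with
  | zero => exact le_rfl
  | succ n ih => exact (nnnorm_sum_le _ _).trans (Finset.sum_le_sum fun a _ => ih _)

theorem listSum_prod (g : α → R) :
    listSum F n (fun l => (l.map g).prod) = (∑ a ∈ F, g a) ^ n := by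
  induction n with
  | zero => simp [listSum]
  | succ n ih =>
    simp only [listSum, List.map_cons, List.prod_cons, listSum_mul_left, ih, ← Finset.sum_mul,
      pow_succ']

theorem listSum_filter (p : α → Prop) [DecidablePred p] (f : List α → M) :
    listSum (F.filter p) n f = listSum F n (fun l => if ∀ a ∈ l, p a then f l else 0) := by
  induction n generalizing f with
  | zero => simp [listSum]
  | succ n ih =>
    simp only [listSum, ih, Finset.sum_filter]
    refine Finset.sum_congr rfl fun a _ => ?_
    by_cases ha : p a <;> simp [ha, listSum_zero]

theorem listSum_eq_sum_piFinset (f : List α → M) :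
    listSum F n f = ∑ C ∈ Fintype.piFinset (fun _ : Fin n => F), f (List.ofFn C) := by
  induction n generalizing f with
  | zero => simp [listSum]
  | succ n ih =>
    simp only [listSum, ih]
    rw [← Finset.sum_product']
    refine Finset.sum_nbij' (fun p => Fin.cons p.1 p.2) (fun C => (C 0, Fin.tail C)) ?_ ?_ ?_ ?_ ?_
    · rintro ⟨a, C⟩ h
      simpa [Fin.forall_fin_succ] using h
    · intro C h
      simpa [Fin.forall_fin_succ, Fin.tail] using h
    · rintro ⟨a, C⟩ _; simp
    · intro C _; simp
    · rintro ⟨a, C⟩ _; simp [List.ofFn_succ]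

theorem listSum_splitSum (H : List α → List α → M) :
    listSum F n (fun l => splitSum l H) =
      ∑ ij ∈ antidiagonal n,
        n.choose ij.1 • listSum F ij.1 (fun A => listSum F ij.2 (fun B => H A B)) := by
  induction n generalizing H with
  | zero => simp [listSum, splitSum]
  | succ n ih =>
    rw [Finset.sum_antidiagonal_choose_succ_nsmul
      (fun i j => listSum F i (fun A => listSum F j (fun B => H A B)))]
    refine Eq.trans ?_ (add_comm _ _)
    simp only [listSum, splitSum, listSum_add, ih, Finset.sum_add_distrib, listSum_sum]
    congr 1 <;> rw [Finset.sum_comm] <;> refine Finset.sum_congr rfl fun ij hij => ?_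
    · rw [← Finset.sum_nsmul, Nat.choose_symm_of_eq_add (mem_antidiagonal.1 hij).symm]
    · exact Finset.sum_nsmul _ _ _

variable {K : Type*} [Semifield K] [CharZero K]

/-- The Leibniz rule: with the weights `1 / n!`, a list together with a splitting of it amounts to
two independent lists. -/
theorem listSum_splitSum_div_factorial (H : List α → List α → K) :
    (n ! : K)⁻¹ * listSum F n (fun l => splitSum l H) =
      ∑ ij ∈ antidiagonal n, (ij.1 ! : K)⁻¹ *
        listSum F ij.1 (fun A => (ij.2 ! : K)⁻¹ * listSum F ij.2 (fun B => H A B)) := by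
  rw [listSum_splitSum, Finset.mul_sum]
  refine Finset.sum_congr rfl fun ij hij => ?_
  obtain rfl := mem_antidiagonal.1 hij
  have h : ((ij.1 + ij.2).choose ij.1 * ij.1 ! * ij.2 ! : K) = (ij.1 + ij.2)! := by
    rw [Nat.choose_symm_add]
    exact_mod_cast Nat.add_choose_mul_factorial_mul_factorial ij.1 ij.2
  have h₁ : (ij.1 ! : K) ≠ 0 := by exact_mod_cast ij.1.factorial_ne_zero
  have h₂ : (ij.2 ! : K) ≠ 0 := by exact_mod_cast ij.2.factorial_ne_zero
  have h₁₂ : ((ij.1 + ij.2).choose ij.1 : K) ≠ 0 := by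
    exact_mod_cast (Nat.choose_pos (Nat.le_add_right _ _)).ne'
  rw [listSum_mul_left, nsmul_eq_mul, ← h]
  field_simp

theorem sum_range_listSum_splitSum (H : List α → List α → K) :
    ∑ m ∈ Finset.range n, (m ! : K)⁻¹ * listSum F m (fun l => splitSum l H) =
      ∑ i ∈ Finset.range n, (i ! : K)⁻¹ * listSum F i (fun A =>
        ∑ j ∈ Finset.range (n - i), (j ! : K)⁻¹ * listSum F j (fun B => H A B)) := by
  have h := Finset.sum_range_diag_flip n (fun i j => (i ! : K)⁻¹ * listSum F i (fun A =>
    (j ! : K)⁻¹ * listSum F j (fun B => H A B)))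
  simp only [listSum_sum, Finset.mul_sum]
  rw [← h]
  refine Finset.sum_congr rfl fun m _ => ?_
  rw [listSum_splitSum_div_factorial, Finset.Nat.sum_antidiagonal_eq_sum_range_succ_mk]

end ListSum

section Mayer

variable {α β : Type*}

/-- The product over all pairs of entries of `1 + ζ`. -/
def pairProd (ζ : α → α → ℤ) : List α → ℤ
  | [] => 1
  | a :: l => (l.map fun b => 1 + ζ a b).prod * pairProd ζ l

/-- The sum of `∏ ζ` over all graphs on the entries of `S` and `V` such that every entry of `V` is
connected to some entry of `S`. The recursion removes the first entry of `S` and adds its neighbours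
in `V` to `S`; the test on the lengths always succeeds, it is there for the termination. -/
def rootedSum (ζ : α → α → ℤ) (S V : List α) : ℤ :=
  match S with
  | [] => if V = [] then 1 else 0
  | v :: S => (S.map fun s => 1 + ζ v s).prod *
      splitSum V fun B A => (B.map (ζ v)).prod *
        if (B ++ A).length = V.length then rootedSum ζ (S ++ B) A else 0
termination_by S.length + V.length
decreasing_by simp at *; omega

theorem rootedSum_nil_left (ζ : α → α → ℤ) (V : List α) [Decidable (V = [])] :
    rootedSum ζ [] V = if V = [] then 1 else 0 := by
  rw [rootedSum]; congr

theorem rootedSum_cons (ζ : α → α → ℤ) (v : α) (S V : List α) :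
    rootedSum ζ (v :: S) V = (S.map fun s => 1 + ζ v s).prod *
      splitSum V fun B A => (B.map (ζ v)).prod * rootedSum ζ (S ++ B) A := by
  rw [rootedSum]
  exact congrArg _ (splitSum_congr fun B A h => by rw [if_pos h.length_eq])

theorem rootedSum_induction {motive : List α → List α → Prop}
    (nil : ∀ V, motive [] V)
    (cons : ∀ v S V, (∀ B A, (B ++ A).Perm V → motive (S ++ B) A) → motive (v :: S) V)
    (S V : List α) : motive S V := by
  induction h : S.length + V.length using Nat.strong_induction_on generalizing S V with
  | _ n ih =>
    cases S with
    | nil => exact nil V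
    | cons v S =>
      refine cons v S V fun B A hBA => ih _ ?_ _ _ rfl
      have := hBA.length_eq
      simp only [List.length_append, List.length_cons] at this h ⊢
      omega

theorem rootedSum_map (ζ : β → β → ℤ) (g : α → β) (S V : List α) :
    rootedSum ζ (S.map g) (V.map g) = rootedSum (fun a b => ζ (g a) (g b)) S V := by
  induction S, V using rootedSum_induction with
  | nil V => classical simp [rootedSum_nil_left]
  | cons v S V ih =>
    rw [List.map_cons, rootedSum_cons, rootedSum_cons, splitSum_list_map, List.map_map]
    refine congrArg _ (splitSum_congr fun B A h => ?_)
    rw [← List.map_append, ih B A h, List.map_map]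
    rfl

theorem pairProd_perm {ζ : α → α → ℤ} (hζ : ∀ a b, ζ a b = ζ b a) {l l' : List α}
    (h : l.Perm l') : pairProd ζ l = pairProd ζ l' := by
  induction h with
  | nil => rfl
  | cons a h ih => simp only [pairProd, ih, (h.map _).prod_eq]
  | swap a b l => simp only [pairProd, List.map_cons, List.prod_cons, hζ a b]; ring
  | trans _ _ h1 h2 => exact h1.trans h2

/-- Every graph on the entries of `S` and `V` splits `V` into the entries that are connected to `S`
and the other ones. -/
theorem splitSum_rootedSum_mul_pairProd {ζ : α → α → ℤ} (hζ : ∀ a b, ζ a b = ζ b a)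
    (S V : List α) :
    splitSum V (fun A B => rootedSum ζ S A * pairProd ζ B) = pairProd ζ (S ++ V) := by
  induction S, V using rootedSum_induction with
  | nil V =>
    classical
    rw [splitSum_eq_nil_left] <;> simp [rootedSum_nil_left]
  | cons v S V ih =>
    have ih' : splitSum V (fun B R => (B.map (ζ v)).prod *
        splitSum R (fun A C => rootedSum ζ (S ++ B) A * pairProd ζ C)) =
        splitSum V (fun B _ => (B.map (ζ v)).prod * pairProd ζ (S ++ V)) :=
      splitSum_congr fun B R h => by
        rw [ih B R h, List.append_assoc, pairProd_perm hζ (h.append_left S)]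
    simp only [rootedSum_cons, mul_assoc, splitSum_mul_left, ← splitSum_mul_right]
    rw [splitSum_assoc V fun B A C => (B.map (ζ v)).prod * (rootedSum ζ (S ++ B) A * pairProd ζ C)]
    simp only [splitSum_mul_left]
    rw [ih', splitSum_mul_right, ← prod_one_add_eq_splitSum, List.cons_append, pairProd,
      List.map_append, List.prod_append, mul_assoc]

theorem splitSum_add_apply_nil {M : Type*} [AddCommMonoid M] {l : List α}
    {H H' : List α → List α → M}
    (h : ∀ A B, (A ++ B).Perm l → B ≠ [] → H A B = H' A B) :
    splitSum l H + H' l [] = splitSum l H' + H l [] := by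
  induction l generalizing H H' with
  | nil => exact add_comm _ _
  | cons a l ih =>
    have h₁ := ih (H := fun A B => H (a :: A) B) (H' := fun A B => H' (a :: A) B)
      fun A B hAB => h _ _ (by simpa using hAB)
    have h₂ : splitSum l (fun A B => H A (a :: B)) = splitSum l fun A B => H' A (a :: B) :=
      splitSum_congr fun A B hAB => h _ _ (List.perm_middle.trans (hAB.cons a)) (by simp)
    rw [splitSum, splitSum, h₂, add_right_comm, h₁, add_right_comm]

theorem eq_of_splitSum_mul_eq {R : Type*} [Ring R] {f g u : List α → R} (hu : u [] = 1)
    {p : List α → Prop} (hp : ∀ {A B V}, (A ++ B).Perm V → p V → p A)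
    (h : ∀ V, p V → splitSum V (fun A B => f A * u B) = splitSum V (fun A B => g A * u B))
    {V : List α} (hV : p V) : f V = g V := by
  induction hn : V.length using Nat.strong_induction_on generalizing V with
  | _ n ih =>
    have := splitSum_add_apply_nil (l := V) (H := fun A B => f A * u B)
      (H' := fun A B => g A * u B) fun A B hAB hB => by
        have := hAB.length_eq
        have := List.length_pos_iff.2 hB
        rw [List.length_append] at *
        rw [ih A.length (by omega) (hp hAB hV) rfl]
    rw [h V hV, hu, mul_one, mul_one] at this
    exact (add_left_cancel this).symm

end Mayer

section ConnectedGraphs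

variable {ι : Type*} [LinearOrder ι] {ζ : ι → ι → ℤ} {v : ι} {W : Finset ι}

/-- The pairs `i < j` of elements of `W`, i.e. the possible edges of a graph with vertices `W`. -/
def pairs (W : Finset ι) : Finset (ι × ι) :=
  {e ∈ W ×ˢ W | e.1 < e.2}

/-- No edge in `E` leaves `U`. -/
def IsClosedUnder (E : Finset (ι × ι)) (U : Finset ι) : Prop :=
  ∀ e ∈ E, e.1 ∈ U ↔ e.2 ∈ U

/-- The edges in `E` connect all vertices in `W` to the vertex `v`. -/
def Connects (E : Finset (ι × ι)) (v : ι) (W : Finset ι) : Prop :=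
  ∀ U, v ∈ U → IsClosedUnder E U → W ⊆ U

open scoped Classical in
/-- The sum of `∏ ζ` over the connected graphs with vertices `W`, for a vertex `v ∈ W`. -/
noncomputable def connectedSum (ζ : ι → ι → ℤ) (v : ι) (W : Finset ι) : ℤ :=
  ∑ E ∈ (pairs W).powerset with Connects E v W, ∏ e ∈ E, ζ e.1 e.2

theorem mem_pairs {e : ι × ι} : e ∈ pairs W ↔ e.1 ∈ W ∧ e.2 ∈ W ∧ e.1 < e.2 := by
  simp [pairs, and_assoc]

theorem pairs_mono {A : Finset ι} (h : A ⊆ W) : pairs A ⊆ pairs W := fun e he => by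
  rw [mem_pairs] at he ⊢
  exact ⟨h he.1, h he.2.1, he.2.2⟩

theorem disjoint_pairs_sdiff (A : Finset ι) : Disjoint (pairs A) (pairs (W \ A)) := by
  simp only [Finset.disjoint_left, mem_pairs, Finset.mem_sdiff]
  tauto

theorem existsUnique_isClosedUnder_connects {E : Finset (ι × ι)} (hE : E ⊆ pairs W) (hv : v ∈ W) :
    ∃! A, A ∈ W.powerset ∧ v ∈ A ∧ IsClosedUnder E A ∧ Connects E v A := by
  classical
  refine ⟨{i ∈ W | ∀ U, v ∈ U → IsClosedUnder E U → i ∈ U}, ⟨?_, ?_, fun e he => ?_, ?_⟩, ?_⟩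
  · exact Finset.mem_powerset.2 (Finset.filter_subset _ _)
  · exact Finset.mem_filter.2 ⟨hv, fun U hU _ => hU⟩
  · obtain ⟨h₁, h₂, -⟩ := mem_pairs.1 (hE he)
    simp only [Finset.mem_filter, h₁, h₂, true_and]
    exact forall₃_congr fun U _ hU => hU e he
  · exact fun U hvU hU i hi => (Finset.mem_filter.1 hi).2 U hvU hU
  · rintro A ⟨hAW, hvA, hA, hEA⟩
    refine Finset.Subset.antisymm (fun i hi => ?_) fun i hi => (Finset.mem_filter.1 hi).2 A hvA hA
    exact Finset.mem_filter.2 ⟨Finset.mem_powerset.1 hAW hi, fun U hvU hU => hEA U hvU hU hi⟩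

section Union

variable {A : Finset ι} {E E₁ E₂ : Finset (ι × ι)}

theorem isClosedUnder_union (h₁ : E₁ ⊆ pairs A) (h₂ : E₂ ⊆ pairs (W \ A)) :
    IsClosedUnder (E₁ ∪ E₂) A := by
  intro e he
  rcases Finset.mem_union.1 he with he | he
  · simp [mem_pairs.1 (h₁ he)]
  · have := mem_pairs.1 (h₂ he)
    simp [Finset.mem_sdiff.1 this.1, Finset.mem_sdiff.1 this.2.1]

theorem IsClosedUnder.inter_union_inter (hA : IsClosedUnder E A) (hE : E ⊆ pairs W) :
    E ∩ pairs A ∪ E ∩ pairs (W \ A) = E := by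
  rw [← Finset.inter_union_distrib_left, Finset.inter_eq_left]
  intro e he
  have := hA e he
  have := mem_pairs.1 (hE he)
  simp only [Finset.mem_union, mem_pairs, Finset.mem_sdiff]
  tauto

theorem connects_union_iff (hv : v ∈ A) (h₁ : E₁ ⊆ pairs A) (h₂ : E₂ ⊆ pairs (W \ A)) :
    Connects (E₁ ∪ E₂) v A ↔ Connects E₁ v A := by
  refine ⟨fun h U hvU hU => ?_,
    fun h U hvU hU => h U hvU fun e he => hU e (Finset.mem_union_left _ he)⟩
  refine (h (A ∩ U) (Finset.mem_inter.2 ⟨hv, hvU⟩) fun e he => ?_).trans Finset.inter_subset_right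
  rcases Finset.mem_union.1 he with he | he
  · simp [isClosedUnder_union h₁ h₂ e (Finset.mem_union_left _ he), hU e he]
  · have := mem_pairs.1 (h₂ he)
    simp [Finset.mem_sdiff.1 this.1, Finset.mem_sdiff.1 this.2.1]

open scoped Classical in
theorem sum_isClosedUnder_connects (hAW : A ⊆ W) (hv : v ∈ A) :
    ∑ E ∈ (pairs W).powerset with IsClosedUnder E A ∧ Connects E v A, ∏ e ∈ E, ζ e.1 e.2 =
      connectedSum ζ v A * ∏ e ∈ pairs (W \ A), (1 + ζ e.1 e.2) := by
  have hd := disjoint_pairs_sdiff (W := W) A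
  rw [connectedSum, Finset.prod_one_add, Finset.sum_mul_sum, ← Finset.sum_product']
  refine Finset.sum_nbij' (fun E => (E ∩ pairs A, E ∩ pairs (W \ A))) (fun p => p.1 ∪ p.2)
    ?_ ?_ ?_ ?_ ?_ <;>
    simp only [Finset.mem_filter, Finset.mem_product, Finset.mem_powerset, and_imp, Prod.forall]
  · intro E hE hA hEA
    refine ⟨⟨Finset.inter_subset_right, ?_⟩, Finset.inter_subset_right⟩
    rwa [← connects_union_iff hv Finset.inter_subset_right Finset.inter_subset_right,
      hA.inter_union_inter hE]
  · intro E₁ E₂ h₁ hE₁ h₂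
    exact ⟨Finset.union_subset (h₁.trans (pairs_mono hAW))
      (h₂.trans (pairs_mono Finset.sdiff_subset)), isClosedUnder_union h₁ h₂,
      (connects_union_iff hv h₁ h₂).2 hE₁⟩
  · exact fun E hE hA _ => hA.inter_union_inter hE
  · intro E₁ E₂ h₁ _ h₂
    rw [Finset.union_inter_distrib_right, Finset.union_inter_distrib_right,
      Finset.inter_eq_left.2 h₁, Finset.inter_eq_left.2 h₂,
      Finset.disjoint_iff_inter_eq_empty.1 (hd.mono_left h₁),
      Finset.disjoint_iff_inter_eq_empty.1 (hd.mono_right h₂).symm, Finset.union_empty,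
      Finset.empty_union]
  · intro E hE hA _
    rw [← Finset.prod_union (hd.mono Finset.inter_subset_right Finset.inter_subset_right),
      hA.inter_union_inter hE]

end Union

/-- Every graph with vertices `W` is determined by the connected component `A` of `v` and the
subgraph on `W \ A`. -/
theorem prod_pairs_one_add (hv : v ∈ W) :
    ∏ e ∈ pairs W, (1 + ζ e.1 e.2) =
      ∑ A ∈ W.powerset with v ∈ A, connectedSum ζ v A * ∏ e ∈ pairs (W \ A), (1 + ζ e.1 e.2) := by
  classical
  calc ∏ e ∈ pairs W, (1 + ζ e.1 e.2)
      = ∑ E ∈ (pairs W).powerset, ∏ e ∈ E, ζ e.1 e.2 := Finset.prod_one_add _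
    _ = ∑ E ∈ (pairs W).powerset, ∑ A ∈ W.powerset with v ∈ A,
          if IsClosedUnder E A ∧ Connects E v A then ∏ e ∈ E, ζ e.1 e.2 else 0 := by
        refine Finset.sum_congr rfl fun E hE => ?_
        obtain ⟨A, hA, hA'⟩ := existsUnique_isClosedUnder_connects (Finset.mem_powerset.1 hE) hv
        rw [Finset.sum_eq_single_of_mem A (Finset.mem_filter.2 ⟨hA.1, hA.2.1⟩) fun B hB hBA => ?_,
          if_pos hA.2.2]
        rw [Finset.mem_filter] at hB
        exact if_neg fun h => hBA (hA' B ⟨hB.1, hB.2, h⟩)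
    _ = _ := by
        rw [Finset.sum_comm]
        refine Finset.sum_congr rfl fun A hA => ?_
        rw [Finset.mem_filter, Finset.mem_powerset] at hA
        rw [← Finset.sum_filter, sum_isClosedUnder_connects hA.1 hA.2]

theorem prod_pairs_insert {M : Type*} [CommMonoid M] {f : ι → ι → M} (hf : ∀ i j, f i j = f j i)
    {a : ι} (ha : a ∉ W) :
    ∏ e ∈ pairs (insert a W), f e.1 e.2 = (∏ b ∈ W, f a b) * ∏ e ∈ pairs W, f e.1 e.2 := by
  have h : pairs (insert a W) = W.image (fun b => (min a b, max a b)) ∪ pairs W := by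
    ext ⟨i, j⟩
    simp only [Finset.mem_union, Finset.mem_image, mem_pairs, Finset.mem_insert, Prod.mk.injEq]
    grind
  rw [h, Finset.prod_union, Finset.prod_image]
  · refine congrArg (· * _) (Finset.prod_congr rfl fun b _ => ?_)
    rcases le_total a b with hab | hab <;> simp [hab, hf a b]
  · intro b _ c _ hbc
    simp only [Prod.mk.injEq] at hbc
    grind
  · rw [Finset.disjoint_left]
    rintro ⟨i, j⟩ h₁ h₂
    simp only [Finset.mem_image, mem_pairs, Prod.mk.injEq] at h₁ h₂
    grind

theorem pairProd_eq_prod_pairs (hζ : ∀ i j, ζ i j = ζ j i) {l : List ι} (hl : l.Nodup) :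
    pairProd ζ l = ∏ e ∈ pairs l.toFinset, (1 + ζ e.1 e.2) := by
  induction l with
  | nil => rfl
  | cons a l ih =>
    obtain ⟨hal, hl⟩ := List.nodup_cons.1 hl
    rw [pairProd, ih hl, ← List.prod_toFinset _ hl, List.toFinset_cons,
      prod_pairs_insert (f := fun i j => 1 + ζ i j) (fun i j => by rw [hζ]) (by simpa using hal)]

theorem splitSum_eq_sum_powerset {M : Type*} [AddCommMonoid M] {l : List ι} (hl : l.Nodup)
    (H : List ι → List ι → M) :
    splitSum l H =
      ∑ J ∈ l.toFinset.powerset, H (l.filter (· ∈ J)) (l.filter (· ∉ J)) := by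
  induction l generalizing H with
  | nil => simp [splitSum]
  | cons a l ih =>
    obtain ⟨hal, hl⟩ := List.nodup_cons.1 hl
    have haF : a ∉ l.toFinset := by simpa using hal
    rw [List.toFinset_cons, Finset.sum_powerset_insert haF, splitSum, ih hl, ih hl, add_comm]
    refine congrArg₂ (· + ·) (Finset.sum_congr rfl fun J hJ => ?_)
      (Finset.sum_congr rfl fun J _ => ?_)
    · have : a ∉ J := fun h => haF (Finset.mem_powerset.1 hJ h)
      simp [this]
    · have h : ∀ x ∈ l, (x ∈ insert a J ↔ x ∈ J) := fun x hx =>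
        Finset.mem_insert.trans (or_iff_right fun hxa => hal (hxa ▸ hx))
      rw [List.filter_cons_of_pos (by simp), List.filter_cons_of_neg (by simp),
        List.filter_congr fun x hx => decide_eq_decide.2 (h x hx),
        List.filter_congr fun x hx => decide_eq_decide.2 (not_congr (h x hx))]

theorem splitSum_connectedSum_mul_pairProd (hζ : ∀ i j, ζ i j = ζ j i) {V : List ι}
    (hV : (v :: V).Nodup) :
    splitSum V (fun A B => connectedSum ζ v (insert v A.toFinset) * pairProd ζ B) =
      pairProd ζ (v :: V) := by
  obtain ⟨hvV, hV'⟩ := List.nodup_cons.1 hV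
  have hv : v ∉ V.toFinset := by simpa using hvV
  have h₀ : ∑ J ∈ V.toFinset.powerset,
      (if v ∈ J then connectedSum ζ v J * ∏ e ∈ pairs (insert v V.toFinset \ J), (1 + ζ e.1 e.2)
      else 0) = 0 :=
    Finset.sum_eq_zero fun J hJ => if_neg fun h => hv (Finset.mem_powerset.1 hJ h)
  rw [pairProd_eq_prod_pairs hζ hV, prod_pairs_one_add (v := v) (by simp), List.toFinset_cons,
    splitSum_eq_sum_powerset hV', Finset.sum_filter, Finset.sum_powerset_insert hv, h₀, zero_add]
  refine Finset.sum_congr rfl fun J hJ => ?_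
  rw [Finset.mem_powerset] at hJ
  rw [if_pos (Finset.mem_insert_self _ _), pairProd_eq_prod_pairs hζ (hV'.filter _)]
  congr 3
  · ext x
    simpa using fun hx => List.mem_toFinset.1 (hJ hx)
  · ext x
    simp only [List.mem_toFinset, List.mem_filter, Finset.mem_sdiff, Finset.mem_insert]
    grind

theorem rootedSum_singleton_eq_connectedSum (hζ : ∀ i j, ζ i j = ζ j i) {V : List ι}
    (hV : (v :: V).Nodup) :
    rootedSum ζ [v] V = connectedSum ζ v (insert v V.toFinset) := by
  refine eq_of_splitSum_mul_eq (f := rootedSum ζ [v]) (u := pairProd ζ)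
    (g := fun V => connectedSum ζ v (insert v V.toFinset)) (p := fun V => (v :: V).Nodup) rfl
    (fun {A B V} h hV => ?_) (fun V hV => ?_) hV
  · exact ((h.cons v).nodup_iff.2 hV).sublist ((List.sublist_append_left A B).cons_cons v)
  · rw [splitSum_connectedSum_mul_pairProd hζ hV, splitSum_rootedSum_mul_pairProd hζ,
      List.singleton_append]

/-- The edges of a graph, as pairs `i < j`. -/
def edgePairs [Fintype ι] (g : SimpleGraph ι) [DecidableRel g.Adj] : Finset (ι × ι) :=
  {e | e.1 < e.2 ∧ g.Adj e.1 e.2}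

theorem isClosedUnder_edgePairs [Fintype ι] {g : SimpleGraph ι} [DecidableRel g.Adj]
    {U : Finset ι} :
    IsClosedUnder (edgePairs g) U ↔ ∀ i j, g.Adj i j → i ∈ U → j ∈ U := by
  simp only [IsClosedUnder, edgePairs, Finset.mem_filter, Finset.mem_univ, true_and, Prod.forall,
    and_imp]
  refine ⟨fun h i j hij hi => ?_, fun h i j _ hij => ⟨h i j hij, h j i hij.symm⟩⟩
  rcases lt_or_gt_of_ne hij.ne with hlt | hlt
  · exact (h i j hlt hij).1 hi
  · exact (h j i hlt hij.symm).2 hi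

theorem connects_edgePairs_univ [Fintype ι] {g : SimpleGraph ι} [DecidableRel g.Adj] (v : ι) :
    Connects (edgePairs g) v Finset.univ ↔ g.Connected := by
  classical
  simp only [Connects, isClosedUnder_edgePairs]
  constructor
  · intro h
    have hv : ∀ w, g.Reachable v w := by
      simpa [Finset.subset_iff] using h {w | g.Reachable v w} (by simp) fun i j hij hi => by
        simp only [Finset.mem_filter, Finset.mem_univ, true_and] at hi ⊢
        exact hi.trans hij.reachable
    exact (SimpleGraph.connected_iff_exists_forall_reachable g).2 ⟨v, hv⟩
  · intro h U hvU hU w hw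
    clear hw
    obtain ⟨p⟩ := h.preconnected v w
    induction p with
    | nil => exact hvU
    | cons hij _ ih => exact ih (hU _ _ hij hvU)

open scoped Classical in
theorem sum_connected_eq_connectedSum [Fintype ι] (v : ι) :
    ∑ g : SimpleGraph ι with g.Connected, ∏ e ∈ edgePairs g, ζ e.1 e.2 =
      connectedSum ζ v Finset.univ := by
  have hright (E : Finset (ι × ι)) (hE : E ⊆ pairs Finset.univ) :
      edgePairs (SimpleGraph.fromRel fun i j => (i, j) ∈ E) = E := by
    ext ⟨i, j⟩
    have h₁ : (i, j) ∈ E → i < j := fun h => (mem_pairs.1 (hE h)).2.2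
    have h₂ : (j, i) ∈ E → j < i := fun h => (mem_pairs.1 (hE h)).2.2
    simp only [edgePairs, Finset.mem_filter, Finset.mem_univ, SimpleGraph.fromRel_adj, true_and]
    grind
  refine Finset.sum_nbij' (fun g => edgePairs g)
    (fun E => SimpleGraph.fromRel fun i j => (i, j) ∈ E)
    ?_ ?_ ?_ ?_ fun g _ => rfl <;>
    simp only [Finset.mem_filter, Finset.mem_univ, true_and, Finset.mem_powerset, and_imp]
  · refine fun g hg => ⟨fun e he => ?_, (connects_edgePairs_univ v).2 hg⟩
    simp only [edgePairs, Finset.mem_filter] at he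
    simp [mem_pairs, he.2.1]
  · intro E hE hEv
    rwa [← connects_edgePairs_univ v, hright E hE]
  · intro g _
    ext i j
    simp only [SimpleGraph.fromRel_adj, edgePairs, Finset.mem_filter, Finset.mem_univ, true_and,
      g.adj_comm j i]
    have : g.Adj i j → i ≠ j := SimpleGraph.Adj.ne
    grind
  · exact fun E hE _ => by convert hright E hE

end ConnectedGraphs

/-- The Mayer function `f = e ^ (-v) - 1` of the hard-core interaction of finite sets. -/
def hardCore {γ : Type*} [DecidableEq γ] (A B : Finset γ) : ℤ :=
  if (A ∩ B).Nonempty then -1 else 0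

/-- The Ursell function of the hard-core interaction, computed with the head of the list as root.
Its value on the empty list is immaterial. -/
def ursell {γ : Type*} [DecidableEq γ] : List (Finset γ) → ℤ
  | [] => 0
  | A :: l => rootedSum hardCore [A] l

open QLattice in
theorem phi_eq_ursell {d k : ℕ} {Λ : Finset (Site d)} (C : Fin (k + 1) → Cluster Λ) :
    phi C = ursell (List.ofFn fun i => (C i).supp) := by
  have hsymm (i j : Fin (k + 1)) :
      hardCore (C i).supp (C j).supp = hardCore (C j).supp (C i).supp := by
    simp only [hardCore, Finset.inter_comm]
  have hnodup : (0 :: List.ofFn (Fin.succ : Fin k → Fin (k + 1))).Nodup := by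
    simpa using List.nodup_ofFn.2 (Fin.succ_injective k)
  have huniv : insert 0 (List.ofFn (Fin.succ : Fin k → Fin (k + 1))).toFinset = Finset.univ := by
    ext i
    induction i using Fin.cases <;> simp
  have hmap := rootedSum_map hardCore (fun i => (C i).supp) [0] (List.ofFn Fin.succ)
  rw [List.map_ofFn, rootedSum_singleton_eq_connectedSum hsymm hnodup, huniv,
    ← sum_connected_eq_connectedSum] at hmap
  rw [List.ofFn_succ]
  exact hmap.symm

theorem sum_range_pow_div_factorial_le {s r : ℝ≥0} (h : Real.exp s ≤ r) (K : ℕ) :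
    ∑ i ∈ Finset.range K, s ^ i / i ! ≤ r := by
  rw [← NNReal.coe_le_coe]
  push_cast
  exact (Real.sum_le_exp_of_nonneg s.2 K).trans h

section KoteckyPreiss

variable {α : Type*} {ζ : α → α → ℤ}

theorem natAbs_list_prod_le_one {l : List ℤ} (h : ∀ x ∈ l, x.natAbs ≤ 1) : l.prod.natAbs ≤ 1 := by
  induction l with
  | nil => simp
  | cons x l ih =>
    rw [List.prod_cons, Int.natAbs_mul]
    exact mul_le_one' (h x (by simp)) (ih fun y hy => h y (List.mem_cons_of_mem _ hy))

theorem natAbs_prod_one_add_le (hζ : ∀ a b, (1 + ζ a b).natAbs ≤ 1) (v : α) (l : List α) :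
    (l.map fun b => 1 + ζ v b).prod.natAbs ≤ 1 :=
  natAbs_list_prod_le_one (by simpa using fun b _ => hζ v b)

theorem natAbs_pairProd_le (hζ : ∀ a b, (1 + ζ a b).natAbs ≤ 1) (l : List α) :
    (pairProd ζ l).natAbs ≤ 1 := by
  induction l with
  | nil => simp [pairProd]
  | cons a l ih =>
    rw [pairProd, Int.natAbs_mul]
    exact mul_le_one' (natAbs_prod_one_add_le hζ a l) ih

theorem natAbs_rootedSum_cons_le (hζ : ∀ a b, (1 + ζ a b).natAbs ≤ 1) (v : α) (S V : List α) :
    (rootedSum ζ (v :: S) V).natAbs ≤ splitSum V fun B A =>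
      (B.map fun b => (ζ v b).natAbs).prod * (rootedSum ζ (S ++ B) A).natAbs := by
  have hprod (B : List α) :
      (B.map (ζ v)).prod.natAbs = (B.map fun b => (ζ v b).natAbs).prod := by
    simpa [Function.comp_def] using map_list_prod Int.natAbsHom (B.map (ζ v))
  rw [rootedSum_cons, Int.natAbs_mul]
  refine (mul_le_of_le_one_left' (natAbs_prod_one_add_le hζ v S)).trans ?_
  refine (natAbs_splitSum_le V _).trans_eq (splitSum_congr fun B A _ => ?_)
  rw [Int.natAbs_mul, hprod]

/-- The series over all finite sequences of polymers in `F` that are connected to `S`, in absolute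
values and truncated at length `K`. -/
noncomputable def rootedMajorant (ζ : α → α → ℤ) (w : α → ℝ≥0) (F : Finset α) (K : ℕ)
    (S : List α) : ℝ≥0 :=
  ∑ m ∈ Finset.range K, (m ! : ℝ≥0)⁻¹ *
    listSum F m fun l => (rootedSum ζ S l).natAbs * (l.map w).prod

theorem rootedMajorant_nil_le (ζ : α → α → ℤ) (w : α → ℝ≥0) (F : Finset α) (K : ℕ) :
    rootedMajorant ζ w F K [] ≤ 1 := by
  classical
  simp only [rootedMajorant, rootedSum_nil_left]
  cases K with
  | zero => simp
  | succ K => simp [Finset.sum_range_succ', listSum, listSum_zero]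

theorem rootedMajorant_cons_le (hζ : ∀ a b, (1 + ζ a b).natAbs ≤ 1) (w : α → ℝ≥0) (F : Finset α)
    (K : ℕ) (v : α) (S : List α) :
    rootedMajorant ζ w F K (v :: S) ≤ ∑ i ∈ Finset.range K, (i ! : ℝ≥0)⁻¹ *
      listSum F i fun B =>
        (B.map fun c => (ζ v c).natAbs * w c).prod * rootedMajorant ζ w F (K - i) (S ++ B) := by
  have hsplit (l : List α) : ((rootedSum ζ (v :: S) l).natAbs * (l.map w).prod : ℝ≥0) ≤
      splitSum l fun B A => (B.map fun c => (ζ v c).natAbs * w c).prod *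
        ((rootedSum ζ (S ++ B) A).natAbs * (A.map w).prod) := by
    have h : ((rootedSum ζ (v :: S) l).natAbs : ℝ≥0) ≤ splitSum l fun B A =>
        (((B.map fun b => (ζ v b).natAbs).prod * (rootedSum ζ (S ++ B) A).natAbs : ℕ) : ℝ≥0) :=
      (Nat.cast_le.2 (natAbs_rootedSum_cons_le hζ v S l)).trans_eq
        (map_splitSum (Nat.castAddMonoidHom ℝ≥0) l _)
    refine (mul_le_mul_left h _).trans_eq ?_
    rw [← splitSum_mul_right]
    refine splitSum_congr fun B A hBA => ?_
    rw [← (hBA.map w).prod_eq, List.map_append, List.prod_append, List.prod_map_mul]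
    push_cast
    rw [List.map_map]
    simp only [Function.comp_def]
    ring
  refine (Finset.sum_le_sum fun m _ => mul_le_mul_right (listSum_mono fun l _ _ => hsplit l)
    _).trans_eq ?_
  simp only [sum_range_listSum_splitSum, rootedMajorant, Finset.mul_sum]
  refine Finset.sum_congr rfl fun i _ => congrArg _ (listSum_congr fun B _ _ => ?_)
  exact Finset.sum_congr rfl fun j _ => by rw [listSum_mul_left, mul_left_comm]

/-- The Kotecký–Preiss bound: `r` is a majorant of the rooted series as soon as it is a
supersolution of the fixed point equation of the series over trees. -/
theorem rootedMajorant_le (hζ : ∀ a b, (1 + ζ a b).natAbs ≤ 1) {w r : α → ℝ≥0} {F : Finset α}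
    (hr : ∀ v, Real.exp ↑(∑ c ∈ F, (ζ v c).natAbs * w c * r c) ≤ r v) (K : ℕ) (S : List α) :
    rootedMajorant ζ w F K S ≤ (S.map r).prod := by
  induction h : S.length + K using Nat.strong_induction_on generalizing S K with
  | _ n ih =>
  cases S with
  | nil => exact rootedMajorant_nil_le ζ w F K
  | cons v S =>
    set s : ℝ≥0 := ∑ c ∈ F, (ζ v c).natAbs * w c * r c
    calc rootedMajorant ζ w F K (v :: S)
        ≤ ∑ i ∈ Finset.range K, (i ! : ℝ≥0)⁻¹ * listSum F i fun B =>
            (B.map fun c => (ζ v c).natAbs * w c).prod * rootedMajorant ζ w F (K - i) (S ++ B) :=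
          rootedMajorant_cons_le hζ w F K v S
      _ ≤ ∑ i ∈ Finset.range K, (i ! : ℝ≥0)⁻¹ * listSum F i fun B =>
            (B.map fun c => (ζ v c).natAbs * w c).prod * ((S ++ B).map r).prod := by
          refine Finset.sum_le_sum fun i hi => mul_le_mul_right (listSum_mono fun B hB _ => ?_) _
          refine mul_le_mul_right (ih _ ?_ (K - i) (S ++ B) rfl) _
          rw [Finset.mem_range] at hi
          simp only [List.length_cons, List.length_append] at h ⊢
          omega
      _ = (∑ i ∈ Finset.range K, s ^ i / i !) * (S.map r).prod := by
          rw [Finset.sum_mul]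
          refine Finset.sum_congr rfl fun i _ => ?_
          have hB (B : List α) : (B.map fun c => (ζ v c).natAbs * w c).prod *
              ((S ++ B).map r).prod =
              (B.map fun c => (ζ v c).natAbs * w c * r c).prod * (S.map r).prod := by
            rw [List.map_append, List.prod_append, List.prod_map_mul (g := r)]
            ring
          simp only [hB, listSum_mul_right, listSum_prod]
          ring
      _ ≤ ((v :: S).map r).prod := by
          rw [List.map_cons, List.prod_cons]
          exact mul_le_mul_left (sum_range_pow_div_factorial_le (hr v) K) _

end KoteckyPreiss

section Exploration

variable {α σ : Type*} [DecidableEq σ] {supp : α → Finset σ}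

/-- The union of the supports of the entries of a list. -/
def listSupp (supp : α → Finset σ) : List α → Finset σ
  | [] => ∅
  | a :: l => supp a ∪ listSupp supp l

/-- Every entry of `l` has nonempty support and is connected to `Y` through entries of `l`: a set
that contains `Y` and is not crossed by any entry contains all of them. -/
def Spanned (supp : α → Finset σ) (Y : Finset σ) (l : List α) : Prop :=
  (∀ a ∈ l, (supp a).Nonempty) ∧
    ∀ U : Finset σ, Y ⊆ U → (∀ a ∈ l, supp a ⊆ U ∨ Disjoint (supp a) U) → ∀ a ∈ l, supp a ⊆ U

theorem mem_listSupp {l : List α} {y : σ} : y ∈ listSupp supp l ↔ ∃ a ∈ l, y ∈ supp a := by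
  induction l with
  | nil => simp [listSupp]
  | cons a l ih => simp [listSupp, ih]

theorem subset_listSupp {l : List α} {a : α} (ha : a ∈ l) : supp a ⊆ listSupp supp l :=
  fun _ hy => mem_listSupp.2 ⟨a, ha, hy⟩

theorem listSupp_subset_iff {l : List α} {U : Finset σ} :
    listSupp supp l ⊆ U ↔ ∀ a ∈ l, supp a ⊆ U := by
  refine ⟨fun h a ha => (subset_listSupp ha).trans h, fun h y hy => ?_⟩
  obtain ⟨a, ha, hya⟩ := mem_listSupp.1 hy
  exact h a ha hya

theorem disjoint_listSupp_iff {l : List α} {U : Finset σ} :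
    Disjoint U (listSupp supp l) ↔ ∀ a ∈ l, Disjoint U (supp a) := by
  induction l with
  | nil => simp [listSupp]
  | cons a l ih => simp [listSupp, ih]

omit [DecidableEq σ] in
theorem spanned_empty_iff {l : List α} : Spanned supp ∅ l ↔ l = [] := by
  refine ⟨fun h => List.eq_nil_iff_forall_not_mem.2 fun a ha => (h.1 a ha).ne_empty ?_, ?_⟩
  · exact Finset.subset_empty.1 (h.2 ∅ le_rfl (fun b _ => Or.inr disjoint_bot_right) a ha)
  · rintro rfl
    simp [Spanned]

theorem Spanned.mem_listSupp {l : List α} {x : σ} (h : Spanned supp {x} l) (hl : l ≠ []) :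
    x ∈ listSupp supp l := by
  by_contra hx
  have hx' : ∀ a ∈ l, x ∉ supp a := fun a ha hxa => hx (subset_listSupp ha hxa)
  obtain ⟨a, ha⟩ := List.exists_mem_of_ne_nil l hl
  obtain ⟨y, hy⟩ := h.1 a ha
  have hy' := h.2 {x} le_rfl
    (fun b hb => Or.inr (Finset.disjoint_singleton_right.2 (hx' b hb))) a ha hy
  exact hx' a ha (Finset.mem_singleton.1 hy' ▸ hy)

theorem Spanned.explore {Y : Finset σ} {x : σ} {l A B : List α} (h : Spanned supp Y l)
    (hl : (B ++ A).Perm l) (hA : ∀ a ∈ A, x ∉ supp a) :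
    Spanned supp ((Y ∪ listSupp supp B).erase x) A := by
  have hmem (a : α) : a ∈ l ↔ a ∈ B ∨ a ∈ A := by rw [← hl.mem_iff, List.mem_append]
  refine ⟨fun a ha => h.1 a ((hmem a).2 (Or.inr ha)), fun U hYU hU a ha => ?_⟩
  have hsub : Y ∪ listSupp supp B ⊆ insert x U := Finset.subset_insert_iff.2 hYU
  refine (Finset.subset_insert_iff_of_notMem (hA a ha)).1 (h.2 (insert x U)
    (Finset.subset_union_left.trans hsub) (fun b hb => ?_) a ((hmem a).2 (Or.inr ha)))
  rcases (hmem b).1 hb with hb | hb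
  · exact Or.inl (((subset_listSupp hb).trans Finset.subset_union_right).trans hsub)
  · exact (hU b hb).imp (fun h => h.trans (Finset.subset_insert _ _)) fun h =>
      Finset.disjoint_insert_right.2 ⟨hA b hb, h⟩

theorem pow_card_erase_listSupp_le {c : ℝ≥0} (hc : 1 ≤ c) (x : σ) (B : List α) :
    c ^ ((listSupp supp B).erase x).card ≤ (B.map fun b => c ^ ((supp b).erase x).card).prod := by
  induction B with
  | nil => simp [listSupp]
  | cons b B ih =>
    rw [listSupp, Finset.erase_union_distrib, List.map_cons, List.prod_cons]
    calc _ ≤ c ^ (((supp b).erase x).card + ((listSupp supp B).erase x).card) :=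
          pow_le_pow_right₀ hc (Finset.card_union_le _ _)
      _ ≤ _ := by rw [pow_add]; gcongr

open scoped Classical in
/-- The series over all finite sequences in `F` that are spanned by `Y`, truncated at length `K`. -/
noncomputable def spannedMajorant (supp : α → Finset σ) (u : α → ℝ≥0) (F : Finset α) (K : ℕ)
    (Y : Finset σ) : ℝ≥0 :=
  ∑ m ∈ Finset.range K, (m ! : ℝ≥0)⁻¹ *
    listSum F m fun l => if Spanned supp Y l then (l.map u).prod else 0

omit [DecidableEq σ] in
theorem spannedMajorant_empty_le (u : α → ℝ≥0) (F : Finset α) (K : ℕ) :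
    spannedMajorant supp u F K ∅ ≤ 1 := by
  simp only [spannedMajorant, spanned_empty_iff]
  cases K with
  | zero => simp
  | succ K => simp [Finset.sum_range_succ', listSum, listSum_zero]

theorem spannedMajorant_le_explore (u : α → ℝ≥0) (F : Finset α) (K : ℕ) (Y : Finset σ) (x : σ) :
    spannedMajorant supp u F K Y ≤ ∑ i ∈ Finset.range K, (i ! : ℝ≥0)⁻¹ *
      listSum {c ∈ F | x ∈ supp c} i fun B => (B.map u).prod *
        spannedMajorant supp u {c ∈ F | x ∉ supp c} (K - i) ((Y ∪ listSupp supp B).erase x) := by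
  classical
  set S : List α → List α → ℝ≥0 := fun B R =>
    if Spanned supp ((Y ∪ listSupp supp B).erase x) R then (R.map u).prod else 0
  set H : List α → List α → ℝ≥0 := fun B R =>
    if (∀ b ∈ B, x ∈ supp b) ∧ (∀ r ∈ R, ¬ x ∈ supp r) then (B.map u).prod * S B R else 0 with hH
  have hsplit (l : List α) :
      (if Spanned supp Y l then (l.map u).prod else 0) ≤ splitSum l H := by
    rw [hH, splitSum_ite_filter (fun c => x ∈ supp c) l]
    have hperm : (l.filter (fun c => x ∈ supp c) ++ l.filter (fun c => ¬ x ∈ supp c)).Perm l := by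
      simpa using List.filter_append_perm (fun c => decide (x ∈ supp c)) l
    split_ifs with h
    · rw [show S _ _ = _ from if_pos (h.explore hperm (by simp)), ← List.prod_append,
        ← List.map_append, (hperm.map u).prod_eq]
    · exact zero_le
  have hfilter (j : ℕ) (B : List α) : listSum F j (H B) =
      if ∀ b ∈ B, x ∈ supp b then (B.map u).prod * listSum {c ∈ F | x ∉ supp c} j (S B) else 0 := by
    rw [listSum_filter, ← listSum_mul_left]
    split_ifs with hB
    · exact listSum_congr fun R _ _ => by simp only [hH, and_iff_right hB, mul_ite, mul_zero]
    · simp [hH, hB, listSum_zero]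
  refine (Finset.sum_le_sum fun m _ => mul_le_mul_right (listSum_mono fun l _ _ => hsplit l)
    _).trans_eq ?_
  rw [sum_range_listSum_splitSum]
  refine Finset.sum_congr rfl fun i _ => congrArg _ ?_
  rw [listSum_filter]
  refine listSum_congr fun B _ _ => ?_
  simp only [hfilter]
  split_ifs with hB
  · simp only [spannedMajorant, Finset.mul_sum, mul_left_comm, S]
  · simp

theorem spannedMajorant_le {u : α → ℝ≥0} {r : ℝ≥0} (hr : 1 ≤ r) {F : Finset α}
    (hF : ∀ x, Real.exp ↑(∑ c ∈ F with x ∈ supp c, u c * r ^ ((supp c).erase x).card) ≤ r)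
    (K : ℕ) (Y : Finset σ) : spannedMajorant supp u F K Y ≤ r ^ Y.card := by
  induction hA : (Y ∪ F.biUnion supp) using Finset.strongInduction generalizing F K Y with
  | _ A ih =>
  rcases Y.eq_empty_or_nonempty with rfl | ⟨x, hx⟩
  · simpa using spannedMajorant_empty_le u F K
  set g : α → ℝ≥0 := fun c => u c * r ^ ((supp c).erase x).card
  have hinner (i : ℕ) (B : List α) (hB : ∀ b ∈ B, b ∈ F) :
      (B.map u).prod *
        spannedMajorant supp u {c ∈ F | x ∉ supp c} (K - i) ((Y ∪ listSupp supp B).erase x) ≤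
      (B.map g).prod * r ^ (Y.erase x).card := by
    rw [List.prod_map_mul, mul_assoc]
    refine mul_le_mul_right ((ih _ ?_ ?_ (K - i) _ rfl).trans ?_) _
    · rw [← hA, Finset.ssubset_iff_of_subset]
      · refine ⟨x, Finset.mem_union_left _ hx, ?_⟩
        simp
      · refine Finset.union_subset ((Finset.erase_subset _ _).trans
          (Finset.union_subset_union_right (listSupp_subset_iff.2 fun b hb => ?_))) ?_
        · exact Finset.subset_biUnion_of_mem supp (hB b hb)
        · exact (Finset.biUnion_subset_biUnion_of_subset_left supp
            (Finset.filter_subset _ _)).trans Finset.subset_union_right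
    · refine fun y => (Real.exp_le_exp.2 (NNReal.coe_le_coe.2 ?_)).trans (hF y)
      exact Finset.sum_le_sum_of_subset (Finset.filter_subset_filter _ (Finset.filter_subset _ _))
    · rw [Finset.erase_union_distrib, mul_comm]
      refine (pow_le_pow_right₀ hr (Finset.card_union_le _ _)).trans ?_
      rw [pow_add]
      exact mul_le_mul_right (pow_card_erase_listSupp_le hr x B) _
  calc spannedMajorant supp u F K Y
      ≤ ∑ i ∈ Finset.range K, (i ! : ℝ≥0)⁻¹ * listSum {c ∈ F | x ∈ supp c} i fun B =>
          (B.map g).prod * r ^ (Y.erase x).card :=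
        (spannedMajorant_le_explore u F K Y x).trans <| Finset.sum_le_sum fun i _ =>
          mul_le_mul_right (listSum_mono fun B _ hB => hinner i B fun b hb =>
            (Finset.mem_filter.1 (hB b hb)).1) _
    _ = (∑ i ∈ Finset.range K, (∑ c ∈ F with x ∈ supp c, g c) ^ i / i !) *
          r ^ (Y.erase x).card := by
        simp only [listSum_mul_right, listSum_prod, Finset.sum_mul, div_eq_inv_mul, mul_assoc]
    _ ≤ r * r ^ (Y.erase x).card := mul_le_mul_left (sum_range_pow_div_factorial_le (hF x) K) _
    _ = r ^ Y.card := by rw [← pow_succ', Finset.card_erase_add_one hx]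

theorem exp_div_one_add_le {a : ℝ} (ha : 0 ≤ a) : Real.exp (a / (1 + a)) ≤ 1 + a := by
  have h := Real.one_sub_inv_le_log_of_pos (show 0 < 1 + a by positivity)
  rw [← Real.le_log_iff_exp_le (by positivity)]
  refine le_of_eq_of_le ?_ h
  field_simp
  ring

theorem spannedMajorant_le_one_add_pow {u : α → ℝ≥0} {a : ℝ≥0} {F : Finset α}
    (hF : ∀ x, ∑ c ∈ F with x ∈ supp c, u c * (1 + a) ^ (supp c).card ≤ a)
    (K : ℕ) (Y : Finset σ) : spannedMajorant supp u F K Y ≤ (1 + a) ^ Y.card := by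
  refine spannedMajorant_le (le_add_of_nonneg_right zero_le) (fun x => ?_) K Y
  have h : ∑ c ∈ F with x ∈ supp c, u c * (1 + a) ^ ((supp c).erase x).card ≤ a / (1 + a) := by
    rw [le_div_iff₀ (by positivity), Finset.sum_mul]
    refine (Finset.sum_congr rfl fun c hc => ?_).trans_le (hF x)
    rw [mul_assoc, ← pow_succ, Finset.card_erase_add_one (Finset.mem_filter.1 hc).2]
  refine (Real.exp_le_exp.2 (NNReal.coe_le_coe.2 h)).trans ?_
  exact_mod_cast exp_div_one_add_le a.2

end Exploration

section ListSeries

open Finset.HasAntidiagonal (antidiagonal mem_antidiagonal)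

variable {α : Type*} {F : Finset α} {f g : List α → ℂ} {w : α → ℝ≥0}

/-- The exponential generating series `∑ f(a₁, …, aₙ) / n!` over all finite sequences in `F`. -/
noncomputable def listSeries (F : Finset α) (f : List α → ℂ) : ℂ :=
  ∑' n : ℕ, (n ! : ℂ)⁻¹ * listSum F n f

theorem norm_listSum_div_factorial_le (hf : ∀ l, ‖f l‖₊ ≤ (l.map w).prod) (n : ℕ) :
    ‖(n ! : ℂ)⁻¹ * listSum F n f‖ ≤ (↑(∑ a ∈ F, w a) : ℝ) ^ n / n ! := by
  rw [norm_mul, norm_inv, Complex.norm_natCast, div_eq_inv_mul]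
  gcongr
  rw [← coe_nnnorm, ← NNReal.coe_pow, ← listSum_prod]
  exact NNReal.coe_le_coe.2 ((nnnorm_listSum_le F n f).trans (listSum_mono fun l _ _ => hf l))

theorem summable_norm_listSum_div_factorial (hf : ∀ l, ‖f l‖₊ ≤ (l.map w).prod) :
    Summable fun n : ℕ => ‖(n ! : ℂ)⁻¹ * listSum F n f‖ :=
  .of_nonneg_of_le (fun _ => norm_nonneg _) (norm_listSum_div_factorial_le hf)
    (Real.summable_pow_div_factorial _)

theorem listSum_splitSum_mul_div_factorial (F : Finset α) (f g : List α → ℂ) (n : ℕ) :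
    (n ! : ℂ)⁻¹ * listSum F n (fun l => splitSum l fun A B => f A * g B) =
      ∑ ij ∈ antidiagonal n,
        ((ij.1 ! : ℂ)⁻¹ * listSum F ij.1 f) * ((ij.2 ! : ℂ)⁻¹ * listSum F ij.2 g) := by
  rw [listSum_splitSum_div_factorial]
  refine Finset.sum_congr rfl fun ij _ => ?_
  simp only [listSum_mul_left, mul_left_comm (ij.2 ! : ℂ)⁻¹, listSum_mul_right, mul_assoc]

theorem summable_listSum_splitSum_mul (hf : ∀ l, ‖f l‖₊ ≤ (l.map w).prod)
    (hg : ∀ l, ‖g l‖₊ ≤ (l.map w).prod) :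
    Summable fun n : ℕ =>
      (n ! : ℂ)⁻¹ * listSum F n (fun l => splitSum l fun A B => f A * g B) := by
  simp only [listSum_splitSum_mul_div_factorial]
  exact (summable_norm_sum_mul_antidiagonal_of_summable_norm
    (summable_norm_listSum_div_factorial hf) (summable_norm_listSum_div_factorial hg)).of_norm

theorem listSeries_splitSum_mul (hf : ∀ l, ‖f l‖₊ ≤ (l.map w).prod)
    (hg : ∀ l, ‖g l‖₊ ≤ (l.map w).prod) :
    listSeries F (fun l => splitSum l fun A B => f A * g B) =
      listSeries F f * listSeries F g := by
  rw [listSeries, listSeries, listSeries, tsum_mul_tsum_eq_tsum_sum_antidiagonal_of_summable_norm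
    (summable_norm_listSum_div_factorial hf) (summable_norm_listSum_div_factorial hg)]
  exact tsum_congr fun n => listSum_splitSum_mul_div_factorial F f g n

theorem listSeries_filter (p : α → Prop) [DecidablePred p] :
    listSeries (F.filter p) f = listSeries F fun l => if ∀ a ∈ l, p a then f l else 0 := by
  simp only [listSeries, listSum_filter]

theorem listSeries_prod (F : Finset α) (z : α → ℂ) :
    listSeries F (fun l => (l.map z).prod) = Complex.exp (∑ a ∈ F, z a) := by
  simp only [listSeries, listSum_prod, ← div_eq_inv_mul]
  rw [Complex.exp_eq_exp_ℂ, NormedSpace.exp_eq_tsum_div]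

end ListSeries

section PowerSeries

open Finset.HasAntidiagonal (antidiagonal mem_antidiagonal)

variable {p q : ℕ → ℂ}

theorem summable_norm_succ_mul_pow (hq : Summable fun n => ‖q n‖) {z : ℂ} (hz : ‖z‖ < 1) :
    Summable fun n => ‖((n + 1 : ℕ) * q n) * z ^ n‖ := by
  have hgeo : Summable fun n : ℕ => ((n + 1 : ℕ) : ℝ) * ‖z‖ ^ n := by
    simpa using summable_choose_mul_geometric_of_norm_lt_one (R := ℝ) 1
      ((norm_norm z).trans_lt hz)
  refine .of_nonneg_of_le (fun _ => norm_nonneg _) (fun n => ?_) (hgeo.mul_left (∑' m, ‖q m‖))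
  rw [norm_mul, norm_mul, norm_pow, Complex.norm_natCast, mul_comm _ ‖q n‖, mul_assoc]
  gcongr
  exact hq.le_tsum n fun _ _ => norm_nonneg _

theorem hasDerivAt_tsum_mul_pow_succ (hq : Summable fun n => ‖q n‖) {z : ℂ} (hz : ‖z‖ < 1) :
    HasDerivAt (fun z => ∑' n, q n * z ^ (n + 1)) (∑' n, ((n + 1 : ℕ) * q n) * z ^ n) z := by
  obtain ⟨ρ, hzρ, hρ⟩ := exists_between hz
  have hρ₀ : 0 < ρ := (norm_nonneg z).trans_lt hzρ
  have hu : Summable fun n => ‖((n + 1 : ℕ) * q n) * (ρ : ℂ) ^ n‖ :=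
    summable_norm_succ_mul_pow hq (by rwa [Complex.norm_of_nonneg hρ₀.le])
  refine hasDerivAt_tsum_of_isPreconnected (g := fun n z => q n * z ^ (n + 1))
    (g' := fun n z => ((n + 1 : ℕ) * q n) * z ^ n) hu Metric.isOpen_ball
    (t := Metric.ball 0 ρ)
    (convex_ball (0 : ℂ) ρ).isPreconnected (fun n y _ => ?_) (fun n y hy => ?_)
    (Metric.mem_ball_self hρ₀) ?_ (by simpa using hzρ)
  · refine ((hasDerivAt_pow (n + 1) y).const_mul (q n)).congr_deriv ?_
    rw [Nat.add_sub_cancel]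
    ring
  · have hy : ‖y‖ < ρ := by simpa using hy
    simp only [norm_mul, norm_pow, Complex.norm_of_nonneg hρ₀.le]
    gcongr
  · simp

theorem continuousOn_tsum_mul_pow_succ (hq : Summable fun n => ‖q n‖) :
    ContinuousOn (fun z : ℂ => ∑' n, q n * z ^ (n + 1)) (Metric.closedBall 0 1) := by
  refine continuousOn_tsum (fun n => by fun_prop) hq fun n z hz => ?_
  rw [norm_mul, norm_pow]
  exact mul_le_of_le_one_right (norm_nonneg _) (pow_le_one₀ (norm_nonneg _) (by simpa using hz))

/-- The recursion says that `B(z) = ∑ p n * z ^ n` and `A(z) = ∑ q n * z ^ (n + 1)` satisfy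
`B' = A' B`, so that `B exp (-A)` is constant. -/
theorem tsum_eq_exp_tsum (hp : Summable fun n => ‖p n‖) (hq : Summable fun n => ‖q n‖)
    (hp₀ : p 0 = 1) (hrec : ∀ n : ℕ, ((n + 1 : ℕ) : ℂ) * p (n + 1) =
      ∑ ij ∈ antidiagonal n, ((ij.1 + 1 : ℕ) * q ij.1) * p ij.2) :
    ∑' n, p n = Complex.exp (∑' n, q n) := by
  have hp' : Summable fun n => ‖p (n + 1)‖ := (summable_nat_add_iff 1).2 hp
  set A : ℂ → ℂ := fun z => ∑' n, q n * z ^ (n + 1) with hA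
  set B : ℂ → ℂ := fun z => 1 + ∑' n, p (n + 1) * z ^ (n + 1) with hB
  have hpow {z : ℂ} (hz : ‖z‖ < 1) : Summable fun n => ‖p n * z ^ n‖ :=
    .of_nonneg_of_le (fun _ => norm_nonneg _) (fun n => by
      rw [norm_mul, norm_pow]
      exact mul_le_of_le_one_right (norm_nonneg _) (pow_le_one₀ (norm_nonneg _) hz.le)) hp
  have hBz {z : ℂ} (hz : ‖z‖ < 1) : B z = ∑' n, p n * z ^ n := by
    rw [(hpow hz).of_norm.tsum_eq_zero_add, hp₀, pow_zero, mul_one]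
  have hder (z : ℂ) (hz : ‖z‖ < 1) : HasDerivAt (fun z => B z * Complex.exp (-A z)) 0 z := by
    have hprod : ∑' n, ((n + 1 : ℕ) * p (n + 1)) * z ^ n =
        (∑' n, ((n + 1 : ℕ) * q n) * z ^ n) * B z := by
      rw [hBz hz, tsum_mul_tsum_eq_tsum_sum_antidiagonal_of_summable_norm
        (summable_norm_succ_mul_pow hq hz) (hpow hz)]
      refine tsum_congr fun n => ?_
      rw [hrec, Finset.sum_mul]
      refine Finset.sum_congr rfl fun ij hij => ?_
      rw [← mem_antidiagonal.1 hij, pow_add]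
      ring
    have hB' : HasDerivAt B _ z := (hasDerivAt_tsum_mul_pow_succ hp' hz).const_add 1
    have hA' : HasDerivAt A _ z := hasDerivAt_tsum_mul_pow_succ hq hz
    refine (hB'.mul hA'.fun_neg.cexp).congr_deriv ?_
    rw [hprod]
    ring
  have hcont : ContinuousOn (fun r : ℝ => B r * Complex.exp (-A r)) (Set.Icc 0 1) := by
    refine ContinuousOn.comp (t := Metric.closedBall 0 1) (g := fun z => B z * Complex.exp (-A z))
      ?_ Complex.continuous_ofReal.continuousOn fun r hr => ?_
    · exact (continuousOn_const.add (continuousOn_tsum_mul_pow_succ hp')).mul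
        (continuousOn_tsum_mul_pow_succ hq).neg.cexp
    · simpa [abs_of_nonneg hr.1] using hr.2
  have hconst := constant_of_has_deriv_right_zero hcont (fun r hr =>
    (hder r (by simpa [abs_of_nonneg hr.1] using hr.2)).comp_ofReal.hasDerivWithinAt) 1
    ⟨zero_le_one, le_rfl⟩
  rw [hp.of_norm.tsum_eq_zero_add, hp₀, ← mul_inv_eq_one₀ (Complex.exp_ne_zero _),
    ← Complex.exp_neg]
  simpa [hA, hB] using hconst

end PowerSeries

section PolymerGas

open Finset.HasAntidiagonal (antidiagonal)

variable {σ : Type*} [DecidableEq σ]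

/-- The weight of a sequence of polymers with activities `ω` under hard-core interaction: the
product of the activities if the polymers are pairwise disjoint, and zero otherwise. -/
noncomputable def polymerWeight (ω : Finset σ → ℂ) (l : List (Finset σ)) : ℂ :=
  (pairProd hardCore l : ℂ) * (l.map ω).prod

/-- The term of order `n + 1` in the Mayer expansion of the polymers in `P`. -/
noncomputable def mayerTerm (ω : Finset σ → ℂ) (P : Finset (Finset σ)) (n : ℕ) : ℂ :=
  ((n + 1)! : ℂ)⁻¹ * listSum P (n + 1) fun l => (ursell l : ℂ) * (l.map ω).prod

theorem hardCore_comm (U V : Finset σ) : hardCore U V = hardCore V U := by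
  rw [hardCore, hardCore, Finset.inter_comm]

theorem natAbs_one_add_hardCore_le (U V : Finset σ) : (1 + hardCore U V).natAbs ≤ 1 := by
  unfold hardCore
  split_ifs <;> decide

theorem nnnorm_polymerWeight_le (ω : Finset σ → ℂ) (l : List (Finset σ)) :
    ‖polymerWeight ω l‖₊ ≤ (l.map fun U => ‖ω U‖₊).prod := by
  have hpair : ‖(pairProd hardCore l : ℂ)‖₊ ≤ 1 := by
    rw [← NNReal.coe_le_coe, coe_nnnorm, Complex.norm_intCast, NNReal.coe_one]
    have h := natAbs_pairProd_le natAbs_one_add_hardCore_le l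
    zify at h
    exact_mod_cast h
  rw [polymerWeight, nnnorm_mul, List.nnnorm_prod, List.map_map]
  exact mul_le_of_le_one_left zero_le hpair

theorem polymerWeight_cons (ω : Finset σ → ℂ) (U : Finset σ) (l : List (Finset σ)) :
    polymerWeight ω (U :: l) = splitSum l fun A B =>
      (ursell (U :: A) : ℂ) * ((U :: A).map ω).prod * polymerWeight ω B := by
  have hcast := map_splitSum (Int.castAddHom ℂ) l fun A B =>
    rootedSum hardCore [U] A * pairProd hardCore B
  simp only [Int.coe_castAddHom] at hcast
  rw [polymerWeight, ← List.singleton_append, ← splitSum_rootedSum_mul_pairProd hardCore_comm,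
    hcast, ← splitSum_mul_right]
  refine splitSum_congr fun A B hAB => ?_
  rw [Int.cast_mul, List.singleton_append, List.map_cons, List.map_cons, List.prod_cons,
    List.prod_cons, ursell, ← (hAB.map ω).prod_eq, List.map_append, List.prod_append, polymerWeight]
  ring

theorem listSeries_polymerWeight (ω : Finset σ → ℂ) (P : Finset (Finset σ))
    (hs : Summable fun n => ‖mayerTerm ω P n‖) :
    listSeries P (polymerWeight ω) = Complex.exp (∑' n, mayerTerm ω P n) := by
  have hfac (n : ℕ) : ((n + 1 : ℕ) : ℂ) * ((n + 1)! : ℂ)⁻¹ = (n ! : ℂ)⁻¹ := by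
    rw [Nat.factorial_succ, Nat.cast_mul, mul_inv,
      mul_inv_cancel_left₀ (Nat.cast_ne_zero.2 n.succ_ne_zero)]
  refine tsum_eq_exp_tsum (summable_norm_listSum_div_factorial (nnnorm_polymerWeight_le ω)) hs
    (by simp [listSum, polymerWeight, pairProd]) fun n => ?_
  simp only [mayerTerm, ← mul_assoc, hfac, listSum, polymerWeight_cons, Finset.mul_sum,
    listSum_splitSum_mul_div_factorial, Finset.sum_mul]
  exact Finset.sum_comm

end PolymerGas

section SiteRecursion

variable {α σ : Type*} [DecidableEq σ] {supp : α → Finset σ} {x : σ}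

/-- The weight `t` satisfies the Kirkwood–Salsburg type expansion at the site `x` with kernel `κ`:
in a sequence that visits `x`, one can split off a subsequence, weighted by `κ`, from whose support
all remaining entries are disjoint. -/
def IsSiteExpansion (supp : α → Finset σ) (x : σ) (t κ : List α → ℂ) : Prop :=
  ∀ l, t l = (if ∀ a ∈ l, x ∉ supp a then t l else 0) + splitSum l fun A B =>
    if ∀ b ∈ B, Disjoint (supp b) (listSupp supp A) then κ A * t B else 0

theorem IsSiteExpansion.ite_subset {t κ : List α → ℂ} (h : IsSiteExpansion supp x t κ)
    (hκ : ∀ l, κ l ≠ 0 → x ∈ listSupp supp l) (A : Finset σ) (l : List α) :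
    (if ∀ a ∈ l, supp a ⊆ A then t l else 0) =
      (if ∀ a ∈ l, supp a ⊆ A.erase x then t l else 0) +
        ∑ U ∈ A.powerset with x ∈ U, splitSum l fun C B =>
          (if listSupp supp C = U then κ C else 0) *
            (if ∀ b ∈ B, supp b ⊆ A \ U then t B else 0) := by
  have hsplit (C B : List α) (hCB : (C ++ B).Perm l) :
      ∑ U ∈ A.powerset with x ∈ U, (if listSupp supp C = U then κ C else 0) *
          (if ∀ b ∈ B, supp b ⊆ A \ U then t B else 0) =
        if ∀ a ∈ l, supp a ⊆ A then
          if ∀ b ∈ B, Disjoint (supp b) (listSupp supp C) then κ C * t B else 0 else 0 := by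
    have hl : (∀ a ∈ l, supp a ⊆ A) ↔ listSupp supp C ⊆ A ∧ ∀ b ∈ B, supp b ⊆ A := by
      simp only [← hCB.mem_iff, List.mem_append, or_imp, forall_and, listSupp_subset_iff]
    by_cases hx : x ∈ listSupp supp C
    · simp only [ite_mul, zero_mul, Finset.sum_ite_eq, Finset.mem_filter, Finset.mem_powerset, hx,
        and_true]
      simp only [hl, Finset.subset_sdiff, ite_and, forall_and, mul_ite, mul_zero]
    · simp [not_imp_comm.1 (hκ C) hx]
  rw [← splitSum_sum, splitSum_congr hsplit]
  by_cases hl : ∀ a ∈ l, supp a ⊆ A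
  · have hx : (∀ a ∈ l, supp a ⊆ A.erase x) ↔ ∀ a ∈ l, x ∉ supp a :=
      forall₂_congr fun a ha => by rw [Finset.subset_erase, and_iff_right (hl a ha)]
    simp only [if_pos hl, hx]
    exact h l
  · have hl' : ¬ ∀ a ∈ l, supp a ⊆ A.erase x := fun h =>
      hl fun a ha => (h a ha).trans (Finset.erase_subset _ _)
    simp [hl, hl', splitSum_zero]

theorem nnnorm_ite_zero_le {p : Prop} [Decidable p] {z : ℂ} {b : ℝ≥0} (h : ‖z‖₊ ≤ b) :
    ‖if p then z else 0‖₊ ≤ b := by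
  split_ifs
  · exact h
  · simp

theorem IsSiteExpansion.listSeries_eq {t κ : List α → ℂ} {w : α → ℝ≥0}
    (h : IsSiteExpansion supp x t κ) (hκ : ∀ l, κ l ≠ 0 → x ∈ listSupp supp l)
    (ht : ∀ l, ‖t l‖₊ ≤ (l.map w).prod) (hκw : ∀ l, ‖κ l‖₊ ≤ (l.map w).prod) (F : Finset α)
    (A : Finset σ) :
    listSeries {a ∈ F | supp a ⊆ A} t = listSeries {a ∈ F | supp a ⊆ A.erase x} t +
      ∑ U ∈ A.powerset with x ∈ U, listSeries F (fun l => if listSupp supp l = U then κ l else 0) *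
        listSeries {a ∈ F | supp a ⊆ A \ U} t := by
  simp only [listSeries_filter]
  rw [Finset.sum_congr rfl fun U _ => (listSeries_splitSum_mul (F := F)
    (fun l => nnnorm_ite_zero_le (p := listSupp supp l = U) (hκw l))
    (fun l => nnnorm_ite_zero_le (p := ∀ a ∈ l, supp a ⊆ A \ U) (ht l))).symm]
  have hsum (U : Finset σ) := summable_listSum_splitSum_mul (F := F)
    (fun l => nnnorm_ite_zero_le (p := listSupp supp l = U) (hκw l))
    (fun l => nnnorm_ite_zero_le (p := ∀ a ∈ l, supp a ⊆ A \ U) (ht l))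
  simp only [h.ite_subset hκ A, listSeries, listSum_add, listSum_sum, mul_add, Finset.mul_sum]
  rw [Summable.tsum_add _ (summable_sum fun U _ => hsum U),
    Summable.tsum_finsetSum fun U _ => hsum U]
  exact (summable_norm_listSum_div_factorial fun l => nnnorm_ite_zero_le (ht l)).of_norm

theorem listSeries_subset_empty {t : List α → ℂ} (F : Finset α)
    (ht : ∀ l, (∀ a ∈ l, supp a = ∅) → t l = (l.map fun a => t [a]).prod) :
    listSeries {a ∈ F | supp a ⊆ ∅} t = Complex.exp (∑ a ∈ F with supp a = ∅, t [a]) := by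
  simp only [Finset.subset_empty]
  rw [← listSeries_prod]
  refine tsum_congr fun n => congrArg _ (listSum_congr fun l _ hl => ht l fun a ha => ?_)
  exact (Finset.mem_filter.1 (hl a ha)).2

theorem eq_of_site_recursion {Z Ξ ω : Finset σ → ℂ} {Λ : Finset σ} (h₀ : Z ∅ = Ξ ∅)
    (hZ : ∀ A ⊆ Λ, ∀ x ∈ A,
      Z A = Z (A.erase x) + ∑ U ∈ A.powerset with x ∈ U, ω U * Z (A \ U))
    (hΞ : ∀ A ⊆ Λ, ∀ x ∈ A,
      Ξ A = Ξ (A.erase x) + ∑ U ∈ A.powerset with x ∈ U, ω U * Ξ (A \ U)) :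
    Z Λ = Ξ Λ := by
  suffices ∀ A ⊆ Λ, Z A = Ξ A from this Λ le_rfl
  intro A
  induction A using Finset.strongInduction with
  | H A ih =>
    intro hA
    rcases A.eq_empty_or_nonempty with rfl | ⟨x, hx⟩
    · exact h₀
    rw [hZ A hA x hx, hΞ A hA x hx,
      ih _ (Finset.erase_ssubset hx) ((Finset.erase_subset _ _).trans hA)]
    refine congrArg _ (Finset.sum_congr rfl fun U hU => ?_)
    rw [Finset.mem_filter, Finset.mem_powerset] at hU
    rw [ih _ (Finset.sdiff_ssubset hU.1 ⟨x, hU.2⟩) (Finset.sdiff_subset.trans hA)]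

end SiteRecursion

section PolymerRecursion

variable {σ : Type*} [DecidableEq σ] (ω : Finset σ → ℂ) (x : σ)

/-- The kernel of the site expansion of a hard-core gas: a single polymer that contains `x`. -/
def polymerKernel : List (Finset σ) → ℂ
  | [U] => if x ∈ U then ω U else 0
  | _ => 0

theorem polymerKernel_cons_cons (U V : Finset σ) (l : List (Finset σ)) :
    polymerKernel ω x (U :: V :: l) = 0 := rfl

theorem mem_listSupp_of_polymerKernel_ne_zero {l : List (Finset σ)}
    (h : polymerKernel ω x l ≠ 0) : x ∈ listSupp id l := by
  match l, h with
  | [U], h => simpa [listSupp] using (ite_ne_right_iff.1 h).1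

theorem nnnorm_polymerKernel_le (l : List (Finset σ)) :
    ‖polymerKernel ω x l‖₊ ≤ (l.map fun U => ‖ω U‖₊).prod := by
  match l with
  | [] => simp [polymerKernel]
  | [U] => simpa [polymerKernel] using nnnorm_ite_zero_le le_rfl
  | _ :: _ :: _ => simp [polymerKernel]

theorem polymerWeight_cons_eq_prod (U : Finset σ) (l : List (Finset σ)) :
    polymerWeight ω (U :: l) =
      ω U * (l.map fun V => 1 + hardCore U V).prod * polymerWeight ω l := by
  simp only [polymerWeight, pairProd, List.map_cons, List.prod_cons]
  push_cast
  ring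

theorem prod_one_add_hardCore (U : Finset σ) (l : List (Finset σ)) :
    (l.map fun V => 1 + hardCore U V).prod = if ∀ V ∈ l, Disjoint V U then 1 else 0 := by
  induction l with
  | nil => simp
  | cons V l ih =>
    rw [List.map_cons, List.prod_cons, ih, hardCore_comm, hardCore]
    by_cases h : Disjoint V U <;> simp [h, ← Finset.not_disjoint_iff_nonempty_inter]

theorem isSiteExpansion_polymerWeight :
    IsSiteExpansion id x (polymerWeight ω) (polymerKernel ω x) := by
  intro l
  induction l with
  | nil => simp [splitSum, polymerKernel]
  | cons U l ih =>
    have hcons (t : ℂ) : t + splitSum (U :: l) (fun A B =>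
        if ∀ V ∈ B, Disjoint V (listSupp id A) then
          polymerKernel ω x A * polymerWeight ω B else 0) =
        t + ((if ∀ V ∈ l, Disjoint V U then polymerKernel ω x [U] * polymerWeight ω l else 0) +
          splitSum l fun A B => if ∀ V ∈ U :: B, Disjoint V (listSupp id A) then
            polymerKernel ω x A * polymerWeight ω (U :: B) else 0) := by
      rw [splitSum, splitSum_eq_nil_left]
      · simp [listSupp]
      · simp [polymerKernel_cons_cons]
    refine Eq.trans ?_ (hcons _).symm
    by_cases hx : x ∈ U
    · rw [splitSum_congr (H' := fun _ _ => 0), splitSum_zero, polymerWeight_cons_eq_prod,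
        prod_one_add_hardCore]
      · simp [hx, polymerKernel]
      · refine fun A B _ => ite_eq_right_iff.2 fun hB => ?_
        have hA : x ∉ listSupp id A := Finset.disjoint_left.1 (hB U List.mem_cons_self) hx
        rw [not_imp_comm.1 (mem_listSupp_of_polymerKernel_ne_zero ω x) hA, zero_mul]
    · conv_lhs => rw [polymerWeight_cons_eq_prod, ih, mul_add, ← splitSum_mul_left]
      have hker : polymerKernel ω x [U] = 0 := if_neg hx
      simp only [hker, hx, zero_mul, ite_self, zero_add, List.forall_mem_cons,
        id, not_false_eq_true, true_and, mul_ite, mul_zero, polymerWeight_cons_eq_prod,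
        prod_one_add_hardCore]
      refine congrArg _ (splitSum_congr fun A B hAB => ?_)
      simp only [← hAB.mem_iff, List.mem_append, or_imp, forall_and, disjoint_listSupp_iff, id]
      have hU : (∀ V ∈ A, Disjoint U V) ↔ ∀ V ∈ A, Disjoint V U := by simp only [disjoint_comm]
      simp only [hU]
      split_ifs <;> first | ring1 | (exfalso; tauto)

theorem listSeries_polymerKernel {U : Finset σ} {P : Finset (Finset σ)} (hU : U ∈ P)
    (hx : x ∈ U) :
    listSeries P (fun l => if listSupp id l = U then polymerKernel ω x l else 0) = ω U := by
  rw [listSeries, tsum_eq_single 1]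
  · simp only [listSum, listSupp, polymerKernel]
    simp +contextual [hU, hx]
  · intro n hn
    rw [listSum_congr (g := fun _ => 0), listSum_zero, mul_zero]
    intro l hl _
    match l, hl with
    | [], _ => simp [polymerKernel]
    | [_], hl => exact absurd hl.symm hn
    | _ :: _ :: _, _ => simp [polymerKernel]

theorem polymerWeight_singleton (U : Finset σ) :
    polymerWeight ω [U] = ω U := by
  simp [polymerWeight, pairProd]

theorem polymerWeight_of_eq_empty {l : List (Finset σ)} (hl : ∀ U ∈ l, U = ∅) :
    polymerWeight ω l = (l.map fun U => polymerWeight ω [U]).prod := by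
  induction l with
  | nil => simp [polymerWeight, pairProd]
  | cons U l ih =>
    rw [List.forall_mem_cons] at hl
    rw [polymerWeight_cons_eq_prod, ih hl.2, prod_one_add_hardCore, hl.1,
      if_pos fun V _ => Finset.disjoint_empty_right V, Int.cast_one, mul_one, List.map_cons,
      List.prod_cons, polymerWeight_singleton]

theorem listSeries_polymerWeight_empty (Λ : Finset σ) :
    listSeries {U ∈ Λ.powerset | U ⊆ ∅} (polymerWeight ω) = Complex.exp (ω ∅) := by
  have hfilter : ({U ∈ Λ.powerset | U = ∅} : Finset (Finset σ)) = {∅} := by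
    ext U
    simp +contextual
  exact (listSeries_subset_empty (supp := id) _ fun l => polymerWeight_of_eq_empty ω).trans <| by
    simp only [id, hfilter, Finset.sum_singleton, polymerWeight_singleton]

end PolymerRecursion

section Components

variable {α σ : Type*} [DecidableEq σ] {supp : α → Finset σ}

/-- The connected component `U` of `x` in the system of the supports of the entries of `l`: the
smallest set that contains `x` and is not crossed by any entry. -/
structure IsComponent (supp : α → Finset σ) (x : σ) (l : List α) (U : Finset σ) : Prop where
  mem : x ∈ U
  not_crossed : ∀ a ∈ l, supp a ⊆ U ∨ Disjoint (supp a) U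
  minimal : ∀ V : Finset σ, x ∈ V → (∀ a ∈ l, supp a ⊆ V ∨ Disjoint (supp a) V) → U ⊆ V

theorem exists_isComponent {l : List α} {x : σ} (hx : x ∈ listSupp supp l) :
    ∃ U, IsComponent supp x l U := by
  classical
  refine ⟨{y ∈ listSupp supp l | ∀ V : Finset σ, x ∈ V →
    (∀ a ∈ l, supp a ⊆ V ∨ Disjoint (supp a) V) → y ∈ V}, ?_, fun a ha => ?_, ?_⟩
  · exact Finset.mem_filter.2 ⟨hx, fun V h _ => h⟩
  · rw [or_iff_not_imp_right, Finset.not_disjoint_iff]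
    rintro ⟨y, hya, hy⟩ z hz
    refine Finset.mem_filter.2 ⟨subset_listSupp ha hz, fun V hxV hV => ?_⟩
    have hyV := (Finset.mem_filter.1 hy).2 V hxV hV
    exact (hV a ha).resolve_right (Finset.not_disjoint_iff.2 ⟨y, hya, hyV⟩) hz
  · exact fun V hxV hV y hy => (Finset.mem_filter.1 hy).2 V hxV hV

theorem IsComponent.eq_listSupp {l A B : List α} {x : σ} {U : Finset σ}
    (hU : IsComponent supp x l U) (hl : (A ++ B).Perm l) (hA : A ≠ []) (hspan : Spanned supp {x} A)
    (hB : ∀ b ∈ B, Disjoint (supp b) (listSupp supp A)) : U = listSupp supp A := by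
  have hmem (a : α) : a ∈ l ↔ a ∈ A ∨ a ∈ B := by rw [← hl.mem_iff, List.mem_append]
  refine (hU.minimal _ (hspan.mem_listSupp hA) fun a ha =>
    ((hmem a).1 ha).imp subset_listSupp (hB a)).antisymm (listSupp_subset_iff.2 ?_)
  exact hspan.2 U (Finset.singleton_subset_iff.2 hU.mem) fun a ha =>
    hU.not_crossed a ((hmem a).2 (Or.inl ha))

omit [DecidableEq σ] in
theorem IsComponent.spanned {l A B : List α} {x : σ} {U : Finset σ}
    (hU : IsComponent supp x l U) (hl : (A ++ B).Perm l) (hA : ∀ a ∈ A, ¬ Disjoint (supp a) U)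
    (hB : ∀ b ∈ B, Disjoint (supp b) U) : Spanned supp {x} A := by
  classical
  have hmem (a : α) : a ∈ l ↔ a ∈ A ∨ a ∈ B := by rw [← hl.mem_iff, List.mem_append]
  have hAU (a : α) (ha : a ∈ A) : supp a ⊆ U :=
    (hU.not_crossed a ((hmem a).2 (Or.inl ha))).resolve_right (hA a ha)
  refine ⟨fun a ha => Finset.nonempty_iff_ne_empty.2 fun h₀ => hA a ha ?_, fun V hxV hV a ha => ?_⟩
  · rw [h₀]
    exact Finset.disjoint_empty_left _
  have hUV : U ⊆ V ∩ U :=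
    hU.minimal _ (Finset.mem_inter.2 ⟨Finset.singleton_subset_iff.1 hxV, hU.mem⟩) fun b hb => by
      rcases (hmem b).1 hb with hb | hb
      · exact (hV b hb).imp (Finset.subset_inter · (hAU b hb))
          (Disjoint.mono_right Finset.inter_subset_left)
      · exact Or.inr ((hB b hb).mono_right Finset.inter_subset_right)
  exact (hAU a ha).trans (hUV.trans Finset.inter_subset_left)

theorem IsComponent.spanned_iff {l A B : List α} {x : σ} {U : Finset σ}
    (hU : IsComponent supp x l U) (hx : x ∈ listSupp supp l) (hl : (A ++ B).Perm l) :
    ((A ≠ [] ∧ Spanned supp {x} A) ∧ ∀ b ∈ B, Disjoint (supp b) (listSupp supp A)) ↔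
      (∀ a ∈ A, ¬ Disjoint (supp a) U) ∧ ∀ b ∈ B, ¬ ¬ Disjoint (supp b) U := by
  simp only [not_not]
  constructor
  · rintro ⟨⟨hA, hspan⟩, hB⟩
    obtain rfl := hU.eq_listSupp hl hA hspan hB
    refine ⟨fun a ha hdisj => (hspan.1 a ha).ne_empty ?_, hB⟩
    exact Finset.disjoint_self_iff_empty _ |>.1 (hdisj.mono_right (subset_listSupp ha))
  · rintro ⟨hA, hB⟩
    have hspan := hU.spanned hl hA hB
    refine ⟨⟨?_, hspan⟩, fun b hb => (hB b hb).mono_right (listSupp_subset_iff.2 ?_)⟩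
    · rintro rfl
      obtain ⟨b, hb, hxb⟩ := mem_listSupp.1 hx
      exact Finset.disjoint_left.1 (hB b (hl.mem_iff.2 hb)) hxb hU.mem
    · exact hspan.2 U (Finset.singleton_subset_iff.2 hU.mem) fun a ha =>
        hU.not_crossed a (hl.mem_iff.1 (List.mem_append_left _ ha))

open scoped Classical in
/-- The restriction of `t` to the sequences that form a single component of the point `x`. -/
noncomputable def spannedKernel (supp : α → Finset σ) (x : σ) (t : List α → ℂ) (l : List α) : ℂ :=
  if l ≠ [] ∧ Spanned supp {x} l then t l else 0

open scoped Classical in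
theorem mem_listSupp_of_spannedKernel_ne_zero {x : σ} {t : List α → ℂ} {l : List α}
    (h : spannedKernel supp x t l ≠ 0) : x ∈ listSupp supp l :=
  let ⟨hl, hspan⟩ := (ite_ne_right_iff.1 h).1
  hspan.mem_listSupp hl

theorem isSiteExpansion_spannedKernel {t : List α → ℂ}
    (ht : ∀ (p : α → Prop) [DecidablePred p] (l : List α),
      (∀ a ∈ l, ∀ b ∈ l, p a → ¬ p b → Disjoint (supp a) (supp b)) →
        t l = t (l.filter p) * t (l.filter fun a => ¬ p a)) (x : σ) :
    IsSiteExpansion supp x t (spannedKernel supp x t) := by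
  classical
  intro l
  by_cases hx : x ∈ listSupp supp l
  · obtain ⟨U, hU⟩ := exists_isComponent hx
    have hvisit : ¬ ∀ a ∈ l, x ∉ supp a := by simpa [mem_listSupp] using hx
    rw [if_neg hvisit, zero_add, splitSum_congr (H' := fun A B =>
      if (∀ a ∈ A, ¬ Disjoint (supp a) U) ∧ ∀ b ∈ B, ¬ ¬ Disjoint (supp b) U then t A * t B else 0)]
    · rw [splitSum_ite_filter (fun a => ¬ Disjoint (supp a) U)]
      refine ht _ l fun a ha b _ hpa hpb => ?_
      exact ((not_not.1 hpb).mono_right ((hU.not_crossed a ha).resolve_right hpa)).symm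
    · intro A B hAB
      simp only [← hU.spanned_iff hx hAB, and_comm (b := ∀ b ∈ B, _), ite_and, spannedKernel,
        ite_mul, zero_mul]
  · have hvisit : ∀ a ∈ l, x ∉ supp a := by simpa [mem_listSupp] using hx
    rw [if_pos hvisit, splitSum_congr (H' := fun _ _ => 0), splitSum_zero, add_zero]
    intro A B hAB
    refine ite_eq_right_iff.2 fun _ => ?_
    have hA : x ∉ listSupp supp A := fun h =>
      let ⟨a, ha, hxa⟩ := mem_listSupp.1 h
      hvisit a (hAB.mem_iff.1 (List.mem_append_left _ ha)) hxa
    rw [not_imp_comm.1 mem_listSupp_of_spannedKernel_ne_zero hA, zero_mul]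

end Components

open QLattice

section LocalAlgebras

open scoped BigOperators

theorem expect_comp_injective {X Y κ M : Type*} [Fintype X] [Fintype Y] [Fintype κ] [Nonempty κ]
    [DecidableEq X] [DecidableEq Y] [AddCommMonoid M] [Module ℚ≥0 M] {e : X → Y}
    (he : Function.Injective e) (f : (X → κ) → M) : 𝔼 τ : Y → κ, f (τ ∘ e) = 𝔼 s, f s := by
  classical
  let E : X ⊕ {y // y ∉ Set.range e} ≃ Y :=
    (Equiv.sumCongr (Equiv.ofInjective e he) (Equiv.refl _)).trans (Equiv.Set.sumCompl _)
  let E' : (Y → κ) ≃ (X → κ) × ({y // y ∉ Set.range e} → κ) :=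
    (Equiv.arrowCongr E.symm (Equiv.refl κ)).trans (Equiv.sumArrowEquivProdArrow _ _ _)
  rw [Fintype.expect_equiv E' (fun τ => f (τ ∘ e)) (fun p => f p.1) fun τ => rfl,
    ← Finset.univ_product_univ, Finset.expect_product]
  exact Finset.expect_congr rfl fun s _ => Fintype.expect_const (f s)

variable {d N : ℕ} {X U V Λ : Finset (Site d)}

theorem embed_mul (h : X ⊆ Λ) (A B : LocalAlg N X) : embed h (A * B) = embed h A * embed h B := by
  ext σ τ
  simp only [Matrix.mul_apply, embed, Matrix.of_apply, ite_mul, zero_mul, mul_ite, mul_zero,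
    ← ite_and]
  rw [← Finset.sum_filter]
  split_ifs with hστ
  · refine Finset.sum_bij'
      (fun s _ => fun x : Λ => if hx : x.1 ∈ X then s ⟨x.1, hx⟩ else σ x)
      (fun ρ _ => fun x : X => ρ ⟨x.1, h x.2⟩) ?_ ?_ ?_ ?_ ?_
    · refine fun s _ => Finset.mem_filter.2 ⟨Finset.mem_univ _, fun x hx => ?_, fun x hx => ?_⟩ <;>
        simp [hx, hστ x hx]
    · simp
    · intro s _
      ext x
      simp
    · intro ρ hρ
      rw [Finset.mem_filter] at hρ
      funext x
      by_cases hx : x.1 ∈ X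
      · simp [hx]
      · simp [hx, hρ.2.1 x hx, hρ.2.2 x hx]
    · intro s _
      simp
  · refine (Finset.sum_eq_zero fun ρ hρ => absurd (fun x hx => ?_) hστ).symm
    rw [Finset.mem_filter] at hρ
    exact (hρ.2.2 x hx).trans (hρ.2.1 x hx)

theorem embed_one (h : X ⊆ Λ) : embed h (1 : LocalAlg N X) = 1 := by
  ext σ τ
  simp only [embed, Matrix.of_apply, Matrix.one_apply, ← ite_and]
  refine if_congr ⟨fun hστ => ?_, ?_⟩ rfl rfl
  · funext x
    by_cases hx : x.1 ∈ X
    · exact congrFun hστ.2 ⟨x.1, hx⟩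
    · exact hστ.1 x hx
  · rintro rfl
    simp

/-- The inclusion `embed` of local algebras as a homomorphism of star algebras. -/
def embedHom (h : X ⊆ Λ) : LocalAlg N X →⋆ₐ[ℂ] LocalAlg N Λ where
  toFun := embed h
  map_one' := embed_one h
  map_mul' := embed_mul h
  map_zero' := by
    ext
    simp [embed]
  map_add' A B := by
    ext
    simp only [embed, Matrix.of_apply, Matrix.add_apply]
    split_ifs <;> simp
  commutes' c := by
    rw [Algebra.algebraMap_eq_smul_one, Algebra.algebraMap_eq_smul_one, ← embed_one (N := N) h]
    ext
    simp only [embed, Matrix.of_apply, Matrix.smul_apply]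
    split_ifs <;> simp
  map_star' A := by
    ext σ
    simp only [embed, Matrix.of_apply, Matrix.star_apply, eq_comm (a := σ _)]
    split_ifs <;> simp

theorem embed_embed (h : X ⊆ U) (h' : U ⊆ Λ) (A : LocalAlg N X) :
    embed h' (embed h A) = embed (h.trans h') A := by
  ext σ τ
  simp only [embed, Matrix.of_apply, ← ite_and]
  refine if_congr ⟨fun hστ x hx => ?_, fun hστ => ⟨fun x hx => hστ x fun hX => hx (h hX),
    fun x hx => hστ ⟨x.1, h' x.2⟩ hx⟩⟩ rfl rfl
  by_cases hU : x.1 ∈ U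
  · exact hστ.2 ⟨x.1, hU⟩ hx
  · exact hστ.1 x hU

theorem embed_mul_embed_apply (hU : U ⊆ Λ) (hV : V ⊆ Λ) (hUV : Disjoint U V) (A : LocalAlg N U)
    (B : LocalAlg N V) (σ τ : Config N Λ) :
    (embed hU A * embed hV B) σ τ = if ∀ x : Λ, x.1 ∉ U → x.1 ∉ V → σ x = τ x then
      A (fun x => σ ⟨x.1, hU x.2⟩) (fun x => τ ⟨x.1, hU x.2⟩) *
        B (fun x => σ ⟨x.1, hV x.2⟩) (fun x => τ ⟨x.1, hV x.2⟩) else 0 := by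
  have hdisj {x} (hx : x ∈ U) : x ∉ V := Finset.disjoint_left.1 hUV hx
  set ρ : Config N Λ := fun x => if x.1 ∈ U then τ x else σ x
  have hρU (x : U) : ρ ⟨x.1, hU x.2⟩ = τ ⟨x.1, hU x.2⟩ := if_pos x.2
  have hρV (x : V) : ρ ⟨x.1, hV x.2⟩ = σ ⟨x.1, hV x.2⟩ := if_neg fun h => hdisj h x.2
  have hleft : ∀ x : Λ, x.1 ∉ U → σ x = ρ x := fun x hx => (if_neg hx).symm
  have hright : (∀ x : Λ, x.1 ∉ V → ρ x = τ x) ↔ ∀ x : Λ, x.1 ∉ U → x.1 ∉ V → σ x = τ x := by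
    refine ⟨fun h x hxU hxV => (hleft x hxU).trans (h x hxV), fun h x hxV => ?_⟩
    by_cases hxU : x.1 ∈ U
    · exact if_pos hxU
    · exact (hleft x hxU).symm.trans (h x hxU hxV)
  simp only [Matrix.mul_apply, embed, Matrix.of_apply]
  rw [Finset.sum_eq_single ρ]
  · simp only [if_pos hleft, hρU, hρV, hright, mul_ite, mul_zero]
  · intro π _ hπ
    rw [ite_zero_mul_ite_zero, if_neg]
    rintro ⟨h₁, h₂⟩
    refine hπ (funext fun x => ?_)
    by_cases hx : x.1 ∈ U
    · exact (h₂ x (hdisj hx)).trans (if_pos hx).symm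
    · exact (h₁ x hx).symm.trans (if_neg hx).symm
  · exact fun h => absurd (Finset.mem_univ _) h

theorem embed_commute (hU : U ⊆ Λ) (hV : V ⊆ Λ) (hUV : Disjoint U V) (A : LocalAlg N U)
    (B : LocalAlg N V) : Commute (embed hU A) (embed hV B) := by
  ext σ τ
  rw [embed_mul_embed_apply hU hV hUV, embed_mul_embed_apply hV hU hUV.symm]
  exact if_congr ⟨fun h x h₁ h₂ => h x h₂ h₁, fun h x h₁ h₂ => h x h₂ h₁⟩ (mul_comm _ _) rfl

theorem ntr_eq_expect (A : LocalAlg N X) : ntr A = 𝔼 σ, A σ σ := by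
  rw [ntr, Fintype.expect_eq_sum_div_card]
  rfl

theorem ntr_one [NeZero N] : ntr (1 : LocalAlg N Λ) = 1 := by
  simp only [ntr_eq_expect, Matrix.one_apply_eq]
  exact Fintype.expect_const _

theorem ntr_embed_mul_embed [NeZero N] (hU : U ⊆ Λ) (hV : V ⊆ Λ) (hUV : Disjoint U V)
    (A : LocalAlg N U) (B : LocalAlg N V) : ntr (embed hU A * embed hV B) = ntr A * ntr B := by
  let e : U ⊕ V → Λ := Sum.elim (fun x => ⟨x.1, hU x.2⟩) (fun x => ⟨x.1, hV x.2⟩)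
  have he : Function.Injective e := by
    refine Function.Injective.sumElim (fun x y h => Subtype.ext (Subtype.mk.inj h))
      (fun x y h => Subtype.ext (Subtype.mk.inj h)) fun x y h => ?_
    have hxy : x.1 = y.1 := congrArg Subtype.val h
    exact Finset.disjoint_left.1 hUV x.2 (hxy ▸ y.2)
  simp only [ntr_eq_expect]
  calc 𝔼 σ, (embed hU A * embed hV B) σ σ
      = 𝔼 σ : Config N Λ, A ((σ ∘ e) ∘ Sum.inl) ((σ ∘ e) ∘ Sum.inl) *
          B ((σ ∘ e) ∘ Sum.inr) ((σ ∘ e) ∘ Sum.inr) :=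
        Finset.expect_congr rfl fun σ _ => by
          rw [embed_mul_embed_apply hU hV hUV, if_pos fun _ _ _ => rfl]
          rfl
    _ = 𝔼 s : U ⊕ V → Fin N, A (s ∘ Sum.inl) (s ∘ Sum.inl) * B (s ∘ Sum.inr) (s ∘ Sum.inr) :=
        expect_comp_injective he fun s =>
          A (s ∘ Sum.inl) (s ∘ Sum.inl) * B (s ∘ Sum.inr) (s ∘ Sum.inr)
    _ = 𝔼 p : Config N U × Config N V, A p.1 p.1 * B p.2 p.2 :=
        Fintype.expect_equiv (Equiv.sumArrowEquivProdArrow U V (Fin N)) _ _ fun _ => rfl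
    _ = (𝔼 σ, A σ σ) * 𝔼 τ, B τ τ := by
        rw [Finset.expect_mul_expect, ← Finset.univ_product_univ, Finset.expect_product]

theorem ntr_embed [NeZero N] (hX : X ⊆ Λ) (A : LocalAlg N X) : ntr (embed hX A) = ntr A := by
  simpa [embed_one, ntr_one] using
    ntr_embed_mul_embed hX (Finset.empty_subset Λ) (Finset.disjoint_empty_right X) A 1

open scoped Matrix.Norms.L2Operator

theorem opNorm_eq_enorm (A : LocalAlg N X) : opNorm A = ‖A‖ₑ := rfl

theorem nnnorm_embed_le (h : X ⊆ Λ) (A : LocalAlg N X) : ‖embed h A‖₊ ≤ ‖A‖₊ :=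
  NonUnitalStarAlgHom.nnnorm_apply_le (embedHom h) A

theorem norm_apply_le (A : LocalAlg N X) (σ τ : Config N X) : ‖A σ τ‖ ≤ ‖A‖ := by
  have h := A.l2_opNorm_mulVec (EuclideanSpace.single τ 1)
  rw [PiLp.norm_single, norm_one, mul_one] at h
  refine le_trans ?_ ((PiLp.norm_apply_le _ σ).trans h)
  simp

theorem nnnorm_ntr_le (A : LocalAlg N X) : ‖ntr A‖₊ ≤ ‖A‖₊ := by
  rw [← NNReal.coe_le_coe, coe_nnnorm, coe_nnnorm, ntr, norm_div, Complex.norm_natCast]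
  refine div_le_of_le_mul₀ (Nat.cast_nonneg _) (norm_nonneg _) ?_
  refine (norm_sum_le _ _).trans ((Finset.sum_le_sum fun σ _ => norm_apply_le A σ σ).trans_eq ?_)
  simp [mul_comm]

theorem hasSum_ntr_exp (M : LocalAlg N X) :
    HasSum (fun n : ℕ => (n ! : ℂ)⁻¹ * ntr (M ^ n)) (ntr (NormedSpace.exp M)) := by
  let T : LocalAlg N X →ₗ[ℂ] ℂ :=
    (Fintype.card (Config N X) : ℂ)⁻¹ • Matrix.traceLinearMap (Config N X) ℂ ℂ
  have hT (A : LocalAlg N X) : T A = ntr A := by simp [T, ntr, div_eq_inv_mul]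
  simpa [hT] using (NormedSpace.exp_series_hasSum_exp' (𝕂 := ℂ) M).mapL T.toContinuousLinearMap

end LocalAlgebras

section TraceProducts

variable {d N : ℕ} {Λ : Finset (Site d)} (Ψ : Interaction d N)

/-- The normalized trace of the product of the interaction terms of a sequence of sets. -/
noncomputable def traceProd (l : List Λ.powerset) : ℂ := ntr (l.map (term Ψ)).prod

open scoped Matrix.Norms.L2Operator in
theorem nnnorm_traceProd_le [NeZero N] (l : List Λ.powerset) :
    ‖traceProd Ψ l‖₊ ≤ (l.map fun X => ‖Ψ X.1‖₊).prod := by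
  refine (nnnorm_ntr_le _).trans ((List.nnnorm_prod_le _).trans ?_)
  rw [List.map_map]
  exact List.prod_map_le_prod_map₀ _ _ (fun _ _ => zero_le) fun X _ => nnnorm_embed_le _ _

theorem exists_embed_eq_prod {U : Finset (Site d)} (hU : U ⊆ Λ) {l : List Λ.powerset}
    (hl : listSupp Subtype.val l ⊆ U) : ∃ A : LocalAlg N U, embed hU A = (l.map (term Ψ)).prod := by
  induction l with
  | nil => exact ⟨1, embed_one hU⟩
  | cons X l ih =>
    rw [listSupp_subset_iff, List.forall_mem_cons, ← listSupp_subset_iff] at hl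
    obtain ⟨A, hA⟩ := ih hl.2
    refine ⟨embed hl.1 (Ψ X.1) * A, ?_⟩
    rw [embed_mul, hA, embed_embed, List.map_cons, List.prod_cons]
    rfl

theorem ntr_prod_mul_prod [NeZero N] {l l' : List Λ.powerset}
    (h : Disjoint (listSupp Subtype.val l) (listSupp Subtype.val l')) :
    ntr ((l.map (term Ψ)).prod * (l'.map (term Ψ)).prod) = traceProd Ψ l * traceProd Ψ l' := by
  have hsub (l : List Λ.powerset) : listSupp Subtype.val l ⊆ Λ :=
    listSupp_subset_iff.2 fun X _ => Finset.mem_powerset.1 X.2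
  obtain ⟨A, hA⟩ := exists_embed_eq_prod Ψ (hsub l) le_rfl
  obtain ⟨B, hB⟩ := exists_embed_eq_prod Ψ (hsub l') le_rfl
  rw [traceProd, traceProd, ← hA, ← hB, ntr_embed_mul_embed _ _ h, ntr_embed, ntr_embed]

theorem prod_map_filter_mul_prod_map_filter_not_of_commute {α M : Type*} [Monoid M]
    (f : α → M) (p : α → Prop) [DecidablePred p] {l : List α}
    (h : ∀ a ∈ l, ∀ b ∈ l, p a → ¬ p b → Commute (f a) (f b)) :
    ((l.filter p).map f).prod * ((l.filter fun a => ¬ p a).map f).prod = (l.map f).prod := by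
  induction l with
  | nil => simp
  | cons b l ih =>
    have ih := ih fun a ha c hc => h a (List.mem_cons_of_mem _ ha) c (List.mem_cons_of_mem _ hc)
    by_cases hb : p b
    · simp [hb, mul_assoc, ← ih]
    · have hcomm : Commute ((l.filter p).map f).prod (f b) := by
        refine Commute.list_prod_left _ _ fun m hm => ?_
        obtain ⟨a, ha, rfl⟩ := List.mem_map.1 hm
        have ⟨hal, hpa⟩ := List.mem_filter.1 ha
        exact h a (List.mem_cons_of_mem _ hal) b List.mem_cons_self (of_decide_eq_true hpa) hb
      simp [hb, ← ih, ← mul_assoc, hcomm.eq]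

theorem traceProd_filter [NeZero N] (p : Λ.powerset → Prop) [DecidablePred p]
    (l : List Λ.powerset) (h : ∀ X ∈ l, ∀ Y ∈ l, p X → ¬ p Y → Disjoint X.1 Y.1) :
    traceProd Ψ l = traceProd Ψ (l.filter p) * traceProd Ψ (l.filter fun X => ¬ p X) := by
  rw [← ntr_prod_mul_prod, prod_map_filter_mul_prod_map_filter_not_of_commute, traceProd]
  · exact fun X hX Y hY hpX hpY => embed_commute _ _ (h X hX Y hY hpX hpY) _ _
  · rw [Finset.disjoint_left]
    intro y hyX hyY
    obtain ⟨X, hX, hyX⟩ := mem_listSupp.1 hyX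
    obtain ⟨Y, hY, hyY⟩ := mem_listSupp.1 hyY
    simp only [List.mem_filter, decide_eq_true_eq] at hX hY
    exact Finset.disjoint_left.1 (h X hX.1 Y hY.1 hX.2 hY.2) hyX hyY

theorem traceProd_of_supp_empty [NeZero N] {l : List Λ.powerset} (hl : ∀ X ∈ l, X.1 = ∅) :
    traceProd Ψ l = (l.map fun X => traceProd Ψ [X]).prod := by
  induction l with
  | nil => exact ntr_one
  | cons X l ih =>
    rw [List.forall_mem_cons] at hl
    rw [List.map_cons, List.prod_cons, ← ih hl.2, ← ntr_prod_mul_prod]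
    · simp [traceProd]
    · simp [listSupp, hl.1]

theorem partitionFunction_eq_listSeries (Φ : Interaction d N) (β : ℂ) :
    partitionFunction Φ Λ β = listSeries Finset.univ (traceProd (Λ := Λ) (-β • Φ)) := by
  have hH : -β • hamiltonian Φ Λ = ∑ X : Λ.powerset, term (-β • Φ) X := by
    rw [hamiltonian, Finset.smul_sum]
    refine Finset.sum_congr rfl fun X _ => ?_
    exact (map_smul (embedHom (Finset.mem_powerset.1 X.2)) (-β) (Φ X.1)).symm
  let T : LocalAlg N Λ →+ ℂ :=
    { toFun := ntr
      map_zero' := by simp [ntr]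
      map_add' := fun A B => by simp [ntr, add_div] }
  rw [partitionFunction, ← (hasSum_ntr_exp _).tsum_eq, listSeries, hH]
  refine tsum_congr fun n => congrArg _ ?_
  rw [← listSum_prod]
  exact map_listSum _ n T _

end TraceProducts

section Clusters

variable {d : ℕ}

theorem subset_of_overlapGraph_reachable {n : ℕ} {S : Fin n → Finset (Site d)}
    {U : Finset (Site d)} (hU : ∀ i, S i ⊆ U ∨ Disjoint (S i) U) {i j : Fin n}
    (hij : (overlapGraph S).Reachable i j) (hi : S i ⊆ U) : S j ⊆ U := by
  rw [SimpleGraph.reachable_iff_reflTransGen] at hij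
  induction hij with
  | refl => exact hi
  | tail _ hadj ih =>
    obtain ⟨y, hy⟩ := hadj.2
    rw [Finset.mem_inter] at hy
    exact (hU _).resolve_right (Finset.not_disjoint_iff.2 ⟨y, hy.2, ih hy.1⟩)

theorem overlapGraph_connected_iff {n : ℕ} {S : Fin n → Finset (Site d)} {i₀ : Fin n} {x : Site d}
    (hx : x ∈ S i₀) : (overlapGraph S).Connected ↔ (∀ i, (S i).Nonempty) ∧
      ∀ U : Finset (Site d), x ∈ U → (∀ i, S i ⊆ U ∨ Disjoint (S i) U) → ∀ i, S i ⊆ U := by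
  classical
  constructor
  · refine fun h => ⟨fun i => ?_, fun U hxU hU i => ?_⟩
    · rcases subsingleton_or_nontrivial (Fin n) with _ | _
      · exact Subsingleton.elim i₀ i ▸ ⟨x, hx⟩
      · obtain ⟨j, hij⟩ := h.preconnected.exists_adj_of_nontrivial i
        exact hij.2.mono Finset.inter_subset_left
    · refine subset_of_overlapGraph_reachable hU (h.preconnected i₀ i) ?_
      exact (hU i₀).resolve_right (Finset.not_disjoint_iff.2 ⟨x, hx, hxU⟩)
  · rintro ⟨hne, hspan⟩
    set U := Finset.univ.biUnion fun j => if (overlapGraph S).Reachable i₀ j then S j else ∅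
    have hmemU {y : Site d} : y ∈ U ↔ ∃ j, (overlapGraph S).Reachable i₀ j ∧ y ∈ S j := by
      simp [U, apply_ite (y ∈ ·)]
    have hsub (i : Fin n) (hi : (overlapGraph S).Reachable i₀ i) : S i ⊆ U :=
      fun y hy => hmemU.2 ⟨i, hi, hy⟩
    have hreach (i : Fin n) {y : Site d} (hyi : y ∈ S i) (hyU : y ∈ U) :
        (overlapGraph S).Reachable i₀ i := by
      obtain ⟨j, hj, hyj⟩ := hmemU.1 hyU
      by_cases hji : j = i
      · exact hji ▸ hj
      · exact hj.trans (SimpleGraph.Adj.reachable ⟨hji, y, Finset.mem_inter.2 ⟨hyj, hyi⟩⟩)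
    have hall : ∀ i, S i ⊆ U := by
      refine hspan U (hsub i₀ (SimpleGraph.Reachable.refl _) hx) fun i => ?_
      rw [or_iff_not_imp_right, Finset.not_disjoint_iff]
      exact fun ⟨y, hyi, hyU⟩ => hsub i (hreach i hyi hyU)
    refine (SimpleGraph.connected_iff_exists_forall_reachable _).2 ⟨i₀, fun i => ?_⟩
    obtain ⟨y, hy⟩ := hne i
    exact hreach i hy (hall i hy)

theorem overlapGraph_connected_iff_spanned {α : Type*} {n : ℕ} {supp : α → Finset (Site d)}
    {X : Fin n → α} {x : Site d} (hx : x ∈ listSupp supp (List.ofFn X)) :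
    (overlapGraph fun i => supp (X i)).Connected ↔ Spanned supp {x} (List.ofFn X) := by
  obtain ⟨a, ha, hxa⟩ := mem_listSupp.1 hx
  obtain ⟨i, rfl⟩ := List.mem_ofFn.1 ha
  simp only [overlapGraph_connected_iff (S := fun i => supp (X i)) hxa, Spanned,
    List.forall_mem_ofFn_iff, Finset.singleton_subset_iff]

variable {Λ : Finset (Site d)}

theorem mem_cluster_supp {C : Cluster Λ} {x : Site d} : x ∈ C.supp ↔ ∃ i, x ∈ (C.X i).1 := by
  simp [Cluster.supp]

theorem cluster_supp_subset (C : Cluster Λ) : C.supp ⊆ Λ :=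
  Finset.biUnion_subset.2 fun i _ => Finset.mem_powerset.1 (C.X i).2

theorem cluster_supp_eq (C : Cluster Λ) : C.supp = listSupp Subtype.val (List.ofFn C.X) := by
  ext x
  simp [mem_cluster_supp, mem_listSupp, List.mem_ofFn']

/-- The sequence underlying a cluster. -/
def clusterSeq (C : Cluster Λ) : Σ n : ℕ, Fin n → Λ.powerset := ⟨C.n, C.X⟩

theorem clusterSeq_injective : Function.Injective (clusterSeq (Λ := Λ)) := by
  rintro ⟨n, X, h⟩ ⟨n', X', h'⟩ hC
  obtain ⟨rfl, hX⟩ := Sigma.mk.injEq _ _ _ _ ▸ hC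
  obtain rfl := eq_of_heq hX
  rfl

/-- The cluster that consists of the empty set. -/
def emptyCluster (Λ : Finset (Site d)) : Cluster Λ where
  n := 1
  X _ := ⟨∅, Finset.empty_mem_powerset Λ⟩
  connected := ⟨fun i j => by rw [Subsingleton.elim i j]⟩

theorem cluster_supp_eq_empty_iff {C : Cluster Λ} : C.supp = ∅ ↔ C = emptyCluster Λ := by
  refine ⟨fun h => ?_, ?_⟩
  · obtain ⟨n, X, hX⟩ := C
    have hX₀ (i : Fin n) : (X i).1 = ∅ :=
      Finset.subset_empty.1 (h ▸ fun x hx => mem_cluster_supp.2 ⟨i, hx⟩)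
    have hn : n ≤ 1 := by
      by_contra! hn
      have : Nontrivial (Fin n) := Fin.nontrivial_iff_two_le.2 hn
      obtain ⟨i⟩ := hX.nonempty
      obtain ⟨j, -, hij⟩ := hX.preconnected.exists_adj_of_nontrivial i
      simp [hX₀] at hij
    obtain rfl : n = 1 := hn.antisymm (Fin.pos_iff_nonempty.2 hX.nonempty)
    obtain rfl : X = fun _ => ⟨∅, Finset.empty_mem_powerset Λ⟩ :=
      funext fun i => Subtype.ext (hX₀ i)
    rfl
  · rintro rfl
    rfl

end Clusters

section ClusterWeights

theorem summable_norm_sigma_div_factorial {α : Type*} [Finite α] {f : List α → ℂ} {w : α → ℝ≥0}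
    (hf : ∀ l, ‖f l‖₊ ≤ (l.map w).prod) :
    Summable fun p : Σ n : ℕ, Fin n → α => ‖(p.1 ! : ℂ)⁻¹ * f (List.ofFn p.2)‖ := by
  have := Fintype.ofFinite α
  refine (summable_sigma_of_nonneg fun p => norm_nonneg _).2
    ⟨fun n => Summable.of_finite, .of_nonneg_of_le (fun n => tsum_nonneg fun X => norm_nonneg _)
      (fun n => ?_) (Real.summable_pow_div_factorial (∑ a, w a : ℝ≥0))⟩
  simp only [tsum_fintype, norm_mul, norm_inv, Complex.norm_natCast, div_eq_inv_mul,
    ← Finset.mul_sum]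
  gcongr
  rw [← NNReal.coe_pow, ← listSum_prod, listSum_eq_sum_piFinset, Fintype.piFinset_univ,
    NNReal.coe_sum]
  exact Finset.sum_le_sum fun X _ => hf _

theorem hasSum_listSeries {α : Type*} [Fintype α] {f : List α → ℂ} {w : α → ℝ≥0}
    (hf : ∀ l, ‖f l‖₊ ≤ (l.map w).prod) :
    HasSum (fun p : Σ n : ℕ, Fin n → α => (p.1 ! : ℂ)⁻¹ * f (List.ofFn p.2))
      (listSeries Finset.univ f) := by
  have hs := (summable_norm_sigma_div_factorial hf).of_norm
  rw [hs.hasSum_iff, hs.tsum_sigma, listSeries]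
  refine tsum_congr fun n => ?_
  rw [tsum_fintype, listSum_eq_sum_piFinset, Fintype.piFinset_univ, Finset.mul_sum]

variable {d N : ℕ} {Λ : Finset (Site d)} (Φ : Interaction d N) (β : ℂ)

theorem weight_eq (C : Cluster Λ) :
    weight Φ β C = (C.n ! : ℂ)⁻¹ * traceProd (-β • Φ) (List.ofFn C.X) := by
  have hterm (X : Λ.powerset) : term (-β • Φ) X = -β • term Φ X :=
    map_smul (embedHom (Finset.mem_powerset.1 X.2)) (-β) (Φ X.1)
  have hprod : ((List.ofFn C.X).map (term (-β • Φ))).prod =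
      (-β) ^ C.n • (List.ofFn fun i => term Φ (C.X i)).prod := by
    have := List.smul_prod (List.ofFn fun i => term Φ (C.X i)) (-β)
    rw [List.length_ofFn] at this
    rw [this, List.map_ofFn, List.map_ofFn]
    simp only [Function.comp_def, hterm]
  rw [weight, traceProd, hprod, ntr, ntr, Matrix.trace_smul, smul_eq_mul]
  ring

theorem summable_norm_weight [NeZero N] :
    Summable fun C : Cluster Λ => ‖weight Φ β C‖ := by
  refine ((summable_norm_sigma_div_factorial (nnnorm_traceProd_le (Λ := Λ) (-β • Φ))).comp_injective
    clusterSeq_injective).congr fun C => ?_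
  rw [weight_eq]
  rfl

open scoped Classical in
theorem hasSum_weight_supp_eq [NeZero N] {x : Site d} {U : Finset (Site d)} (hx : x ∈ U) :
    HasSum (fun C : Cluster Λ => if C.supp = U then weight Φ β C else 0)
      (listSeries Finset.univ fun l : List Λ.powerset =>
        if listSupp Subtype.val l = U then
          spannedKernel Subtype.val x (traceProd (-β • Φ)) l else 0) := by
  have hS := hasSum_listSeries (f := fun l : List Λ.powerset =>
    if listSupp Subtype.val l = U then spannedKernel Subtype.val x (traceProd (-β • Φ)) l else 0)
    fun l => nnnorm_ite_zero_le (nnnorm_ite_zero_le (nnnorm_traceProd_le _ l))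
  have hrange (p) (hp : p ∉ Set.range (clusterSeq (Λ := Λ))) : ((p.1 ! : ℂ)⁻¹ *
      if listSupp Subtype.val (List.ofFn p.2) = U then
        spannedKernel Subtype.val x (traceProd (-β • Φ)) (List.ofFn p.2) else 0) = 0 := by
    have hspan : ¬ (List.ofFn p.2 ≠ [] ∧ Spanned Subtype.val {x} (List.ofFn p.2)) := fun h =>
      hp ⟨⟨p.1, p.2, (overlapGraph_connected_iff_spanned (h.2.mem_listSupp h.1)).2 h.2⟩, rfl⟩
    rw [spannedKernel, if_neg hspan, ite_self, mul_zero]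
  convert (clusterSeq_injective.hasSum_iff hrange).2 hS using 1
  funext C
  simp only [Function.comp_apply, clusterSeq, ← cluster_supp_eq, weight_eq]
  by_cases hC : C.supp = U
  · have hxC : x ∈ listSupp Subtype.val (List.ofFn C.X) := by rwa [← cluster_supp_eq, hC]
    have hne : List.ofFn C.X ≠ [] := fun h => by simp [h, listSupp] at hxC
    rw [if_pos hC, if_pos hC, spannedKernel,
      if_pos ⟨hne, (overlapGraph_connected_iff_spanned hxC).1 C.connected⟩]
  · rw [if_neg hC, if_neg hC, mul_zero]

end ClusterWeights

section FiberSums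

variable {γ τ : Type*} [DecidableEq τ] {S : γ → τ}

/-- The sum of `f` over the fibre of `S` above `u`. -/
noncomputable def fiberSum {M : Type*} [AddCommMonoid M] [TopologicalSpace M] (S : γ → τ)
    (f : γ → M) (u : τ) : M :=
  ∑' c, if S c = u then f c else 0

theorem summable_ite_of_summable_norm {𝕜 : Type*} [NormedField 𝕜] {f : γ → 𝕜}
    (hf : Summable fun c => ‖f c‖) (p : γ → Prop) [DecidablePred p] :
    Summable fun c => ‖if p c then f c else 0‖ := by
  refine .of_nonneg_of_le (fun _ => norm_nonneg _) (fun c => ?_) hf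
  split_ifs <;> simp

theorem summable_norm_and_hasSum_prod_apply {𝕜 : Type*} [NormedField 𝕜] [CompleteSpace 𝕜]
    {n : ℕ} {h : Fin n → γ → 𝕜} (hh : ∀ i, Summable fun c => ‖h i c‖) :
    (Summable fun C : Fin n → γ => ‖∏ i, h i (C i)‖) ∧
      HasSum (fun C : Fin n → γ => ∏ i, h i (C i)) (∏ i, ∑' c, h i c) := by
  induction n with
  | zero => exact ⟨Summable.of_finite, by simp [hasSum_unique]⟩
  | succ n ih =>
    obtain ⟨hs, ht⟩ := ih fun i => hh i.succ
    have hs' := (hh 0).mul_norm hs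
    have ht' := (hh 0).of_norm.hasSum.mul ht hs'.of_norm
    let e : γ × (Fin n → γ) ≃ (Fin (n + 1) → γ) := Fin.consEquiv fun _ => γ
    refine ⟨e.summable_iff.1 (hs'.congr fun p => ?_), ?_⟩
    · simp [e, Fin.prod_univ_succ]
    · rw [← e.hasSum_iff, Fin.prod_univ_succ]
      exact ht'.congr_fun fun p => by simp [e, Fin.prod_univ_succ]

theorem hasSum_comp_mul_prod {𝕜 : Type*} [NormedField 𝕜] [CompleteSpace 𝕜]
    {P : Finset τ} (hP : ∀ c, S c ∈ P) {f : γ → 𝕜} (hf : Summable fun c => ‖f c‖) (g : List τ → 𝕜)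
    (n : ℕ) : HasSum (fun C : Fin n → γ => g (List.ofFn fun i => S (C i)) * ∏ i, f (C i))
      (listSum P n fun l => g l * (l.map (fiberSum S f)).prod) := by
  simp only [listSum_eq_sum_piFinset, List.map_ofFn, List.prod_ofFn, Function.comp_def]
  have h := hasSum_sum (s := Fintype.piFinset fun _ : Fin n => P) fun L _ =>
    (summable_norm_and_hasSum_prod_apply fun i =>
      summable_ite_of_summable_norm hf (S · = L i)).2.mul_left (g (List.ofFn L))
  refine h.congr_fun fun C => ?_
  rw [Finset.sum_eq_single fun i => S (C i)]
  · simp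
  · intro L _ hL
    obtain ⟨i, hi⟩ := Function.ne_iff.1 hL
    rw [Finset.prod_eq_zero (Finset.mem_univ i) (if_neg hi.symm), mul_zero]
  · exact fun h => absurd (Fintype.mem_piFinset.2 fun i => hP (C i)) h

theorem hasSum_comp_mul_prod_nnreal {P : Finset τ} (hP : ∀ c, S c ∈ P) {f : γ → ℝ≥0}
    (hf : Summable f) (g : List τ → ℝ≥0) (n : ℕ) :
    HasSum (fun C : Fin n → γ => g (List.ofFn fun i => S (C i)) * ∏ i, f (C i))
      (listSum P n fun l => g l * (l.map (fiberSum S f)).prod) := by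
  have hcoe : fiberSum S (fun c => (f c : ℝ)) = fun u => ((fiberSum S f u : ℝ≥0) : ℝ) := by
    funext u
    rw [fiberSum, fiberSum, NNReal.coe_tsum]
    exact tsum_congr fun c => by split_ifs <;> rfl
  have h := hasSum_comp_mul_prod hP (f := fun c => (f c : ℝ))
    (by simpa only [NNReal.norm_eq] using NNReal.summable_coe.2 hf) (fun l => (g l : ℝ)) n
  have hsum : ((listSum P n fun l => g l * (l.map (fiberSum S f)).prod : ℝ≥0) : ℝ) =
      listSum P n fun l => ((g l * (l.map (fiberSum S f)).prod : ℝ≥0) : ℝ) :=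
    map_listSum P n (NNReal.toRealHom : ℝ≥0 →+ ℝ) _
  rw [← NNReal.hasSum_coe, hsum]
  simpa only [NNReal.coe_mul, NNReal.coe_prod, NNReal.coe_list_prod, List.map_map,
    Function.comp_def, hcoe] using h

theorem sum_fiberSum_mul_le {f : γ → ℝ≥0} (hf : Summable f) {P : Finset τ} {g : τ → ℝ≥0}
    {b : ℝ≥0} (hb : ∀ F : Finset γ, ∑ c ∈ F, (if S c ∈ P then f c * g (S c) else 0) ≤ b) :
    ∑ u ∈ P, fiberSum S f u * g u ≤ b := by
  have hs (u : τ) : Summable fun c => (if S c = u then f c else 0) * g u :=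
    (NNReal.summable_of_le (fun c => by split_ifs <;> simp) hf).mul_right _
  simp only [fiberSum, ← NNReal.tsum_mul_right]
  rw [← Summable.tsum_finsetSum fun u _ => hs u]
  refine Summable.tsum_le_of_sum_le (summable_sum fun u _ => hs u) fun F => ?_
  simpa only [ite_mul, zero_mul, Finset.sum_ite_eq] using hb F

end FiberSums

section PolymerBounds

variable {σ : Type*} [DecidableEq σ] {P : Finset (Finset σ)} {W f : Finset σ → ℝ≥0} {a r : ℝ≥0}

theorem sum_inter_nonempty_le (hf : ∀ x, ∑ U ∈ P with x ∈ U, f U ≤ a) (V : Finset σ) :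
    ∑ U ∈ P with (V ∩ U).Nonempty, f U ≤ V.card * a := by
  calc ∑ U ∈ P with (V ∩ U).Nonempty, f U
      ≤ ∑ U ∈ P, ∑ x ∈ V, if x ∈ U then f U else 0 := by
        rw [Finset.sum_filter]
        refine Finset.sum_le_sum fun U _ => ?_
        split_ifs with hU
        · obtain ⟨x, hx⟩ := hU
          obtain ⟨hxV, hxU⟩ := Finset.mem_inter.1 hx
          simpa only [if_pos hxU] using
            Finset.single_le_sum (f := fun x => if x ∈ U then f U else 0)
              (fun _ _ => zero_le) hxV
        · exact zero_le
    _ = ∑ x ∈ V, ∑ U ∈ P with x ∈ U, f U := by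
        simp only [Finset.sum_filter]
        exact Finset.sum_comm
    _ ≤ V.card * a := by
        rw [← nsmul_eq_mul]
        exact Finset.sum_le_card_nsmul V _ a fun x _ => hf x

theorem rootedMajorant_hardCore_le (hr : Real.exp a ≤ r)
    (hW : ∀ x, ∑ U ∈ P with x ∈ U, W U * r ^ U.card ≤ a) (K : ℕ) (V : Finset σ) :
    rootedMajorant hardCore W P K [V] ≤ r ^ V.card := by
  have hKP (V : Finset σ) :
      Real.exp ↑(∑ U ∈ P, (hardCore V U).natAbs * W U * r ^ U.card) ≤ ↑(r ^ V.card) := by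
    have hsum : ∑ U ∈ P, (hardCore V U).natAbs * W U * r ^ U.card ≤ V.card * a := by
      refine le_trans (le_of_eq ?_) (sum_inter_nonempty_le hW V)
      rw [Finset.sum_filter]
      refine Finset.sum_congr rfl fun U _ => ?_
      rw [hardCore]
      split_ifs <;> simp
    calc Real.exp ↑(∑ U ∈ P, (hardCore V U).natAbs * W U * r ^ U.card)
        ≤ Real.exp (V.card * a) := Real.exp_le_exp.2 (by exact_mod_cast hsum)
      _ = Real.exp a ^ V.card := Real.exp_nat_mul _ _
      _ ≤ ↑(r ^ V.card) := by
        rw [NNReal.coe_pow]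
        gcongr
  simpa using rootedMajorant_le natAbs_one_add_hardCore_le hKP K [V]

theorem sum_range_listSum_ursell_le (hr : Real.exp a ≤ r)
    (hW : ∀ x, ∑ U ∈ P with x ∈ U, W U * r ^ U.card ≤ a) (K : ℕ) :
    ∑ k ∈ Finset.range K, ((k + 1)! : ℝ≥0)⁻¹ *
        listSum P (k + 1) (fun l => (ursell l).natAbs * (l.map W).prod) ≤
      ∑ U ∈ P, W U * r ^ U.card := by
  calc ∑ k ∈ Finset.range K, ((k + 1)! : ℝ≥0)⁻¹ *
        listSum P (k + 1) (fun l => (ursell l).natAbs * (l.map W).prod)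
      ≤ ∑ k ∈ Finset.range K, (k ! : ℝ≥0)⁻¹ *
        listSum P (k + 1) (fun l => (ursell l).natAbs * (l.map W).prod) := by
        gcongr
        simp
    _ = ∑ U ∈ P, W U * rootedMajorant hardCore W P K [U] := by
        simp only [listSum, ursell, rootedMajorant, Finset.mul_sum, List.map_cons, List.prod_cons,
          mul_left_comm _ (W _), listSum_mul_left]
        exact Finset.sum_comm
    _ ≤ ∑ U ∈ P, W U * r ^ U.card := by
        gcongr with U
        exact rootedMajorant_hardCore_le hr hW K U

end PolymerBounds

section WeightBounds

variable {d N : ℕ} {Λ : Finset (Site d)} {Φ : Interaction d N} {β : ℂ} {a r : ℝ≥0}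

open scoped Matrix.Norms.L2Operator

/-- The norm `max_{x ∈ Λ} ∑_{x ∈ X ⊆ Λ} ‖Φ_X‖ s ^ |X|` of an interaction in the finite volume `Λ`.
Unlike `interactionNorm`, it is always finite. -/
noncomputable def localNorm (Φ : Interaction d N) (Λ : Finset (Site d)) (s : ℝ≥0) : ℝ≥0 :=
  Λ.sup fun x => ∑ X : Λ.powerset with x ∈ X.1, ‖Φ X.1‖₊ * s ^ X.1.card

theorem localNorm_le_interactionNorm (Φ : Interaction d N) (Λ : Finset (Site d)) (s : ℝ≥0) :
    (localNorm Φ Λ s : ℝ≥0∞) ≤ interactionNorm Φ s := by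
  rw [localNorm, ENNReal.coe_finset_sup]
  refine Finset.sup_le fun x _ => le_iSup_of_le x ?_
  calc ((∑ X : Λ.powerset with x ∈ X.1, ‖Φ X.1‖₊ * s ^ X.1.card : ℝ≥0) : ℝ≥0∞)
      = ∑ X ∈ Λ.powerset, {X | x ∈ X}.indicator
          (fun X => opNorm (Φ X) * ENNReal.ofReal s ^ X.card) X := by
        rw [← Finset.sum_coe_sort Λ.powerset, Finset.sum_filter, ENNReal.ofNNReal_finsetSum]
        refine Finset.sum_congr rfl fun X _ => ?_
        by_cases hx : x ∈ X.1 <;> simp [hx, opNorm_eq_enorm, enorm_eq_nnnorm]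
    _ ≤ ∑' X, {X | x ∈ X}.indicator (fun X => opNorm (Φ X) * ENNReal.ofReal s ^ X.card) X :=
        ENNReal.sum_le_tsum _
    _ = ∑' X : {X : Finset (Site d) // x ∈ X}, opNorm (Φ X.1) * ENNReal.ofReal s ^ X.1.card :=
        (tsum_subtype {X : Finset (Site d) | x ∈ X} _).symm

theorem sum_nnnorm_mul_pow_le_localNorm (Φ : Interaction d N) (Λ : Finset (Site d)) (s : ℝ≥0)
    (x : Site d) :
    ∑ X : Λ.powerset with x ∈ X.1, ‖Φ X.1‖₊ * s ^ X.1.card ≤ localNorm Φ Λ s := by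
  by_cases hx : x ∈ Λ
  · exact Finset.le_sup (f := fun x => ∑ X : Λ.powerset with x ∈ X.1, ‖Φ X.1‖₊ * s ^ X.1.card) hx
  · rw [Finset.sum_eq_zero]
    · exact zero_le
    · intro X hX
      exact absurd (Finset.mem_powerset.1 X.2 (Finset.mem_filter.1 hX).2) hx

theorem nnnorm_weight_le [NeZero N] (Φ : Interaction d N) (β : ℂ) (C : Cluster Λ) :
    ‖weight Φ β C‖₊ ≤ (C.n ! : ℝ≥0)⁻¹ * ((List.ofFn C.X).map fun X => ‖β‖₊ * ‖Φ X.1‖₊).prod := by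
  rw [weight_eq, nnnorm_mul, nnnorm_inv, Complex.nnnorm_natCast]
  gcongr
  refine (nnnorm_traceProd_le _ _).trans_eq ?_
  simp only [Pi.smul_apply, nnnorm_smul, nnnorm_neg]

theorem pow_card_listSupp_le (hr : 1 ≤ r) (l : List Λ.powerset) :
    r ^ (listSupp Subtype.val l).card ≤ (l.map fun X => r ^ X.1.card).prod := by
  induction l with
  | nil => simp [listSupp]
  | cons X l ih =>
    calc r ^ (listSupp Subtype.val (X :: l)).card
        ≤ r ^ (X.1.card + (listSupp Subtype.val l).card) :=
          pow_le_pow_right₀ hr (Finset.card_union_le _ _)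
      _ ≤ ((X :: l).map fun X => r ^ X.1.card).prod := by
          rw [pow_add, List.map_cons, List.prod_cons]
          gcongr

theorem nnnorm_weight_mul_pow_le [NeZero N] (hr : 1 ≤ r) (C : Cluster Λ) :
    ‖weight Φ β C‖₊ * r ^ C.supp.card ≤ (C.n ! : ℝ≥0)⁻¹ *
      ((List.ofFn C.X).map fun X => ‖β‖₊ * ‖Φ X.1‖₊ * r ^ X.1.card).prod := by
  rw [List.prod_map_mul, ← mul_assoc, cluster_supp_eq]
  gcongr
  · exact nnnorm_weight_le Φ β C
  · exact pow_card_listSupp_le hr _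

theorem one_add_sum_cluster_le_spannedMajorant (u : Λ.powerset → ℝ≥0) (x : Site d)
    (F : Finset (Cluster Λ)) : ∃ K, 1 + ∑ C ∈ F with x ∈ C.supp,
      (C.n ! : ℝ≥0)⁻¹ * ((List.ofFn C.X).map u).prod ≤
        spannedMajorant Subtype.val u Finset.univ K {x} := by
  classical
  let G : (Σ n : ℕ, Fin n → Λ.powerset) → ℝ≥0 := fun p => (p.1 ! : ℝ≥0)⁻¹ *
    if Spanned Subtype.val {x} (List.ofFn p.2) then ((List.ofFn p.2).map u).prod else 0
  let I := (F.filter fun C => x ∈ C.supp).image clusterSeq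
  have hnil : (⟨0, Fin.elim0⟩ : Σ n : ℕ, Fin n → Λ.powerset) ∉ I := by
    intro h
    obtain ⟨C, -, hC⟩ := Finset.mem_image.1 h
    obtain ⟨i⟩ := C.connected.nonempty
    have hn : C.n = 0 := congrArg Sigma.fst hC
    exact (hn ▸ i).elim0
  refine ⟨F.sup Cluster.n + 1, ?_⟩
  calc 1 + ∑ C ∈ F with x ∈ C.supp, (C.n ! : ℝ≥0)⁻¹ * ((List.ofFn C.X).map u).prod
      = ∑ p ∈ insert ⟨0, Fin.elim0⟩ I, G p := by
        rw [Finset.sum_insert hnil, Finset.sum_image clusterSeq_injective.injOn]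
        congr 1
        · simp [G, Spanned]
        · refine Finset.sum_congr rfl fun C hC => ?_
          have hx := (Finset.mem_filter.1 hC).2
          rw [cluster_supp_eq] at hx
          simp only [G, clusterSeq,
            if_pos ((overlapGraph_connected_iff_spanned hx).1 C.connected)]
    _ ≤ ∑ p ∈ (Finset.range (F.sup Cluster.n + 1)).sigma fun _ => Finset.univ, G p := by
        refine Finset.sum_le_sum_of_subset fun p hp => ?_
        rw [Finset.mem_sigma, Finset.mem_range, Nat.lt_succ_iff]
        refine ⟨?_, Finset.mem_univ _⟩
        obtain rfl | hp := Finset.mem_insert.1 hp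
        · exact Nat.zero_le _
        · obtain ⟨C, hC, rfl⟩ := Finset.mem_image.1 hp
          exact Finset.le_sup (f := Cluster.n) (Finset.mem_filter.1 hC).1
    _ = spannedMajorant Subtype.val u Finset.univ (F.sup Cluster.n + 1) {x} := by
        rw [Finset.sum_sigma, spannedMajorant]
        refine Finset.sum_congr rfl fun n _ => ?_
        rw [listSum_eq_sum_piFinset, Fintype.piFinset_univ, Finset.mul_sum]

theorem sum_nnnorm_weight_mem_le [NeZero N] (hr : 1 ≤ r)
    (h : ‖β‖₊ * localNorm Φ Λ (r * (1 + a)) ≤ a) (F : Finset (Cluster Λ)) (x : Site d) :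
    ∑ C ∈ F with x ∈ C.supp, ‖weight Φ β C‖₊ * r ^ C.supp.card ≤ a := by
  let u : Λ.powerset → ℝ≥0 := fun X => ‖β‖₊ * ‖Φ X.1‖₊ * r ^ X.1.card
  have hu (x : Site d) : ∑ X : Λ.powerset with x ∈ X.1, u X * (1 + a) ^ X.1.card ≤ a := by
    refine le_trans (le_of_eq ?_)
      ((mul_le_mul_right (sum_nnnorm_mul_pow_le_localNorm Φ Λ (r * (1 + a)) x) _).trans h)
    simp only [u, Finset.mul_sum, mul_pow, mul_assoc]
  obtain ⟨K, hK⟩ := one_add_sum_cluster_le_spannedMajorant u x F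
  have hsp := hK.trans (spannedMajorant_le_one_add_pow hu K {x})
  rw [Finset.card_singleton, pow_one, add_le_add_iff_left] at hsp
  exact (Finset.sum_le_sum fun C _ => nnnorm_weight_mul_pow_le hr C).trans hsp

end WeightBounds

section PolymerActivities

variable {d N : ℕ} {Λ : Finset (Site d)} (Φ : Interaction d N) (β : ℂ) {a r : ℝ≥0}

/-- The activity of the polymer `U` is the total weight of the clusters with support `U`. -/
noncomputable def activity (Λ U : Finset (Site d)) : ℂ :=
  fiberSum (Cluster.supp (Λ := Λ)) (weight Φ β) U

/-- The total absolute weight of the clusters with support `U`. -/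
noncomputable def absActivity (Λ U : Finset (Site d)) : ℝ≥0 :=
  fiberSum (Cluster.supp (Λ := Λ)) (fun C => ‖weight Φ β C‖₊) U

theorem sum_absActivity_mem_le [NeZero N] (hr : 1 ≤ r)
    (h : ‖β‖₊ * localNorm Φ Λ (r * (1 + a)) ≤ a) (x : Site d) :
    ∑ U ∈ Λ.powerset with x ∈ U, absActivity Φ β Λ U * r ^ U.card ≤ a := by
  refine sum_fiberSum_mul_le (NNReal.summable_coe.1 (summable_norm_weight Φ β)) fun F => ?_
  simpa only [Finset.mem_filter, Finset.mem_powerset, cluster_supp_subset, true_and,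
    ← Finset.sum_filter] using sum_nnnorm_weight_mem_le hr h F x

theorem fiberSum_supp_empty {M : Type*} [AddCommMonoid M] [TopologicalSpace M]
    (f : Cluster Λ → M) : fiberSum Cluster.supp f ∅ = f (emptyCluster Λ) := by
  rw [fiberSum, tsum_eq_single (emptyCluster Λ)
    fun C hC => if_neg (mt cluster_supp_eq_empty_iff.1 hC),
    if_pos (cluster_supp_eq_empty_iff.2 rfl)]

open scoped Matrix.Norms.L2Operator in
theorem sum_absActivity_le [NeZero N] (hr : 1 ≤ r)
    (h : ‖β‖₊ * localNorm Φ Λ (r * (1 + a)) ≤ a) :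
    ∑ U ∈ Λ.powerset, absActivity Φ β Λ U * r ^ U.card ≤ ‖β‖₊ * ‖Φ ∅‖₊ + Λ.card * a := by
  rw [← Finset.sum_erase_add _ _ (Finset.empty_mem_powerset Λ), add_comm]
  refine add_le_add ?_ ?_
  · rw [absActivity, fiberSum_supp_empty, Finset.card_empty, pow_zero, mul_one]
    simpa [emptyCluster] using nnnorm_weight_le Φ β (emptyCluster Λ)
  · refine (Finset.sum_le_sum_of_subset fun U hU => ?_).trans
      (sum_inter_nonempty_le (sum_absActivity_mem_le Φ β hr h) Λ)
    obtain ⟨hne, hU⟩ := Finset.mem_erase.1 hU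
    rw [Finset.mem_filter, Finset.inter_eq_right.2 (Finset.mem_powerset.1 hU)]
    exact ⟨hU, Finset.nonempty_iff_ne_empty.2 hne⟩

theorem listSeries_spannedKernel [NeZero N] {x : Site d} {U : Finset (Site d)} (hx : x ∈ U) :
    (listSeries Finset.univ fun l : List Λ.powerset => if listSupp Subtype.val l = U then
      spannedKernel Subtype.val x (traceProd (-β • Φ)) l else 0) = activity Φ β Λ U := by
  rw [activity, fiberSum]
  convert (hasSum_weight_supp_eq Φ β hx).tsum_eq.symm

theorem listSeries_traceProd_empty [NeZero N] :
    listSeries {X : Λ.powerset | X.1 ⊆ ∅} (traceProd (-β • Φ)) =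
      Complex.exp (activity Φ β Λ ∅) := by
  have hfilter : ({X : Λ.powerset | X.1 = ∅} : Finset Λ.powerset) =
      {⟨∅, Finset.empty_mem_powerset Λ⟩} := by
    ext X
    simp [Subtype.ext_iff]
  rw [listSeries_subset_empty (supp := Subtype.val) _ fun l => traceProd_of_supp_empty _, hfilter,
    Finset.sum_singleton, activity, fiberSum_supp_empty, weight_eq]
  simp [emptyCluster]

theorem partitionFunction_eq_polymer_listSeries [NeZero N] :
    partitionFunction Φ Λ β = listSeries Λ.powerset (polymerWeight (activity Φ β Λ)) := by
  classical
  set ω := activity Φ β Λ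
  have hZ (A : Finset (Site d)) (x : Site d) :=
    (isSiteExpansion_spannedKernel (traceProd_filter (Λ := Λ) (-β • Φ)) x).listSeries_eq
      (fun _ => mem_listSupp_of_spannedKernel_ne_zero) (nnnorm_traceProd_le _)
      (fun l => nnnorm_ite_zero_le (nnnorm_traceProd_le _ l)) Finset.univ A
  have hΞ (A : Finset (Site d)) (x : Site d) :=
    (isSiteExpansion_polymerWeight ω x).listSeries_eq
      (fun _ => mem_listSupp_of_polymerKernel_ne_zero ω x) (nnnorm_polymerWeight_le ω)
      (nnnorm_polymerKernel_le ω x) Λ.powerset A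
  have h := eq_of_site_recursion (Λ := Λ) (ω := ω)
    (Z := fun A => listSeries {X : Λ.powerset | X.1 ⊆ A} (traceProd (-β • Φ)))
    (Ξ := fun A => listSeries {U ∈ Λ.powerset | id U ⊆ A} (polymerWeight ω)) ?_
    (fun A _ x _ => ?_) fun A hA x _ => ?_
  · rw [partitionFunction_eq_listSeries]
    convert h
    · ext X
      simpa using Finset.mem_powerset.1 X.2
    · ext U
      simp
  · exact (listSeries_traceProd_empty Φ β).trans (listSeries_polymerWeight_empty ω Λ).symm
  · refine (hZ A x).trans (congrArg _ (Finset.sum_congr rfl fun U hU => ?_))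
    rw [listSeries_spannedKernel Φ β (Finset.mem_filter.1 hU).2]
  · refine (hΞ A x).trans (congrArg _ (Finset.sum_congr rfl fun U hU => ?_))
    have ⟨hUA, hx⟩ := Finset.mem_filter.1 hU
    rw [listSeries_polymerKernel ω x
      (Finset.mem_powerset.2 ((Finset.mem_powerset.1 hUA).trans hA)) hx]

end PolymerActivities

section Expansion

open scoped Matrix.Norms.L2Operator

/-- The cluster expansion of the logarithm of the partition function. -/
noncomputable def clusterSum {d N : ℕ} (Φ : Interaction d N) (Λ : Finset (Site d))
    (β : ℂ) : ℂ :=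
  ∑' p : Σ k : ℕ, Fin (k + 1) → Cluster Λ, 1 / ((p.1 + 1)! : ℂ) * clusterTerm Φ β p.2

variable {d N : ℕ} [NeZero N] {Λ : Finset (Site d)} {Φ : Interaction d N} {β : ℂ} {a r : ℝ≥0}

theorem nnnorm_intCast_eq_natAbs (z : ℤ) : ‖(z : ℂ)‖₊ = z.natAbs := by
  ext
  rw [coe_nnnorm, Complex.norm_intCast, NNReal.coe_natCast, Nat.cast_natAbs, Int.cast_abs]

variable (Φ β) in
theorem hasSum_nnnorm_clusterTerm (k : ℕ) :
    HasSum (fun C : Fin (k + 1) → Cluster Λ => ‖clusterTerm Φ β C‖₊)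
      (listSum Λ.powerset (k + 1) fun l =>
        (ursell l).natAbs * (l.map (absActivity Φ β Λ)).prod) := by
  refine (hasSum_comp_mul_prod_nnreal (fun C => Finset.mem_powerset.2 (cluster_supp_subset C))
    (NNReal.summable_coe.1 (summable_norm_weight Φ β))
    (fun l => ((ursell l).natAbs : ℝ≥0)) (k + 1)).congr_fun fun C => ?_
  rw [clusterTerm, phi_eq_ursell, nnnorm_mul, nnnorm_prod, nnnorm_intCast_eq_natAbs]

variable (Φ β) in
theorem summable_nnnorm_clusterTerm_fixed_length (k : ℕ) :
    Summable fun C : Fin (k + 1) → Cluster Λ => ‖1 / ((k + 1)! : ℂ) * clusterTerm Φ β C‖₊ := by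
  simp only [nnnorm_mul]
  exact (hasSum_nnnorm_clusterTerm Φ β k).summable.mul_left _

variable (Φ β) in
theorem hasSum_clusterTerm_div_factorial (k : ℕ) :
    HasSum (fun C : Fin (k + 1) → Cluster Λ => 1 / ((k + 1)! : ℂ) * clusterTerm Φ β C)
      (mayerTerm (activity Φ β Λ) Λ.powerset k) := by
  rw [mayerTerm, ← one_div]
  refine ((hasSum_comp_mul_prod (fun C => Finset.mem_powerset.2 (cluster_supp_subset C))
    (summable_norm_weight Φ β) (fun l => (ursell l : ℂ)) (k + 1)).mul_left _).congr_fun fun C => ?_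
  rw [clusterTerm, phi_eq_ursell]

theorem sum_range_tsum_nnnorm_clusterTerm_le (hr : Real.exp a ≤ r)
    (h : ‖β‖₊ * localNorm Φ Λ (r * (1 + a)) ≤ a) (K : ℕ) :
    ∑ k ∈ Finset.range K, ∑' C : Fin (k + 1) → Cluster Λ,
      ‖1 / ((k + 1)! : ℂ) * clusterTerm Φ β C‖₊ ≤ ‖β‖₊ * ‖Φ ∅‖₊ + Λ.card * a := by
  have hr₁ : 1 ≤ r := (Real.one_le_exp a.2).trans hr
  simp only [one_div, nnnorm_mul, nnnorm_inv, Complex.nnnorm_natCast, NNReal.tsum_mul_left,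
    (hasSum_nnnorm_clusterTerm Φ β _).tsum_eq]
  exact (sum_range_listSum_ursell_le hr (sum_absActivity_mem_le Φ β hr₁ h) K).trans
    (sum_absActivity_le Φ β hr₁ h)

theorem summable_nnnorm_clusterTerm (hr : Real.exp a ≤ r)
    (h : ‖β‖₊ * localNorm Φ Λ (r * (1 + a)) ≤ a) :
    Summable fun p : Σ k : ℕ, (Fin (k + 1) → Cluster Λ) =>
      ‖1 / ((p.1 + 1)! : ℂ) * clusterTerm Φ β p.2‖₊ :=
  NNReal.summable_sigma.2 ⟨summable_nnnorm_clusterTerm_fixed_length Φ β,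
    NNReal.summable_of_sum_range_le (sum_range_tsum_nnnorm_clusterTerm_le hr h)⟩

theorem norm_clusterSum_le (hr : Real.exp a ≤ r)
    (h : ‖β‖₊ * localNorm Φ Λ (r * (1 + a)) ≤ a) :
    ‖clusterSum Φ Λ β‖ ≤ ‖β‖ * ‖Φ ∅‖ + Λ.card * a := by
  have hs := summable_nnnorm_clusterTerm hr h
  have hle : ‖clusterSum Φ Λ β‖₊ ≤ ‖β‖₊ * ‖Φ ∅‖₊ + Λ.card * a := by
    refine (nnnorm_tsum_le hs).trans ?_
    rw [Summable.tsum_sigma' (summable_nnnorm_clusterTerm_fixed_length Φ β) hs]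
    exact NNReal.tsum_le_of_sum_range_le (sum_range_tsum_nnnorm_clusterTerm_le hr h)
  exact_mod_cast hle

theorem clusterSum_eq (hr : Real.exp a ≤ r) (h : ‖β‖₊ * localNorm Φ Λ (r * (1 + a)) ≤ a) :
    clusterSum Φ Λ β = ∑' k : ℕ, 1 / ((k + 1)! : ℂ) *
      ∑' C : Fin (k + 1) → Cluster Λ, clusterTerm Φ β C := by
  rw [clusterSum, (summable_nnnorm_clusterTerm hr h).of_nnnorm.tsum_sigma]
  simp only [tsum_mul_left]

theorem partitionFunction_eq_exp_clusterSum (hr : Real.exp a ≤ r)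
    (h : ‖β‖₊ * localNorm Φ Λ (r * (1 + a)) ≤ a) :
    partitionFunction Φ Λ β = Complex.exp (clusterSum Φ Λ β) := by
  have hs : Summable fun p : Σ k : ℕ, (Fin (k + 1) → Cluster Λ) =>
      ‖1 / ((p.1 + 1)! : ℂ) * clusterTerm Φ β p.2‖ :=
    NNReal.summable_coe.2 (summable_nnnorm_clusterTerm hr h)
  have hmayer (k : ℕ) := (hasSum_clusterTerm_div_factorial (Λ := Λ) Φ β k).tsum_eq
  have hsum : Summable fun k => ‖mayerTerm (activity Φ β Λ) Λ.powerset k‖ := by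
    refine .of_nonneg_of_le (fun _ => norm_nonneg _) (fun k => ?_) hs.sigma
    rw [← hmayer]
    exact norm_tsum_le_tsum_norm (hs.sigma_factor k)
  rw [partitionFunction_eq_polymer_listSeries, listSeries_polymerWeight _ _ hsum, clusterSum,
    hs.of_norm.tsum_sigma]
  exact congrArg Complex.exp (tsum_congr fun k => (hmayer k).symm)

variable (Φ β) in
theorem hasSum_nnnorm_phi_cons (C₁ : Cluster Λ) (k : ℕ) :
    HasSum (fun C : Fin k → Cluster Λ =>
        ‖(phi (Fin.cons C₁ C : Fin (k + 1) → Cluster Λ) : ℂ)‖₊ * ∏ i, ‖weight Φ β (C i)‖₊)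
      (listSum Λ.powerset k fun l =>
        (rootedSum hardCore [C₁.supp] l).natAbs * (l.map (absActivity Φ β Λ)).prod) := by
  refine (hasSum_comp_mul_prod_nnreal (fun C => Finset.mem_powerset.2 (cluster_supp_subset C))
    (NNReal.summable_coe.1 (summable_norm_weight Φ β))
    (fun l => ((rootedSum hardCore [C₁.supp] l).natAbs : ℝ≥0)) k).congr_fun fun C => ?_
  rw [phi_eq_ursell, nnnorm_intCast_eq_natAbs, List.ofFn_succ, ursell]
  simp only [Fin.cons_zero, Fin.cons_succ]

theorem tsum_rooted_clusters_le (hr : Real.exp a ≤ r)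
    (h : ‖β‖₊ * localNorm Φ Λ (r * (1 + a)) ≤ a) (C₁ : Cluster Λ) :
    1 + ∑' k : ℕ, ((k + 2 : ℕ) : ℝ≥0∞) / ((k + 2)! : ℝ≥0∞) *
        ∑' C : Fin (k + 1) → Cluster Λ,
          ‖(phi (Fin.cons C₁ C : Fin (k + 2) → Cluster Λ) : ℂ)‖ₑ * ∏ i, ‖weight Φ β (C i)‖ₑ
      ≤ (r ^ C₁.supp.card : ℝ≥0) := by
  let T (k : ℕ) : ℝ≥0 := (k ! : ℝ≥0)⁻¹ * listSum Λ.powerset k fun l =>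
    (rootedSum hardCore [C₁.supp] l).natAbs * (l.map (absActivity Φ β Λ)).prod
  have hT (k : ℕ) : ((k + 2 : ℕ) : ℝ≥0∞) / ((k + 2)! : ℝ≥0∞) *
      ∑' C : Fin (k + 1) → Cluster Λ, ‖(phi (Fin.cons C₁ C : Fin (k + 2) → Cluster Λ) : ℂ)‖ₑ *
        ∏ i, ‖weight Φ β (C i)‖ₑ = T (k + 1) := by
    have hfactorial : ((k + 2 : ℕ) : ℝ≥0) / ((k + 2)! : ℝ≥0) = ((k + 1)! : ℝ≥0)⁻¹ := by
      rw [Nat.factorial_succ (k + 1), Nat.cast_mul, div_mul_cancel_left₀ (by positivity)]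
    rw [ENNReal.coe_mul, ← hfactorial, ENNReal.coe_div (by positivity), ENNReal.coe_natCast,
      ENNReal.coe_natCast, ← (hasSum_nnnorm_phi_cons Φ β C₁ (k + 1)).tsum_eq,
      ENNReal.coe_tsum (hasSum_nnnorm_phi_cons Φ β C₁ (k + 1)).summable]
    simp only [enorm_eq_nnnorm, ENNReal.coe_mul, ENNReal.ofNNReal_finsetProd]
  have hT₀ : (T 0 : ℝ≥0∞) = 1 := by simp [T, listSum, rootedSum, splitSum]
  rw [tsum_congr hT, ← hT₀, ← tsum_eq_zero_add' (f := fun k => (T k : ℝ≥0∞)) ENNReal.summable]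
  refine ENNReal.tsum_le_of_sum_range_le fun K => ?_
  rw [← ENNReal.ofNNReal_finsetSum, ENNReal.coe_le_coe]
  exact rootedMajorant_hardCore_le hr
    (sum_absActivity_mem_le Φ β ((Real.one_le_exp a.2).trans hr) h) K C₁.supp

end Expansion

section BoundedSequence

theorem norm_taylorCoeff_le {f : ℂ → ℂ} {ρ M : ℝ} (hρ : 0 < ρ)
    (hf : DifferentiableOn ℂ f (Metric.closedBall 0 ρ))
    (hM : ∀ z ∈ Metric.closedBall 0 ρ, ‖f z‖ ≤ M) (j : ℕ) :
    ‖(j ! : ℂ)⁻¹ * iteratedDeriv j f 0‖ ≤ M / ρ ^ j := by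
  have hd : DiffContOnCl ℂ f (Metric.ball 0 ρ) :=
    DifferentiableOn.diffContOnCl (by rwa [closure_ball _ hρ.ne'])
  have hcauchy := Complex.norm_iteratedDeriv_le_of_forall_mem_sphere_norm_le j hρ hd
    fun z hz => hM z (Metric.sphere_subset_closedBall hz)
  rwa [norm_mul, norm_inv, Complex.norm_natCast, inv_mul_le_iff₀ (by positivity), ← mul_div_assoc]

theorem norm_mul_pow_le_geometric {c z : ℂ} {M ρ r : ℝ} {j : ℕ} (hz : ‖z‖ ≤ r)
    (hc : ‖c‖ ≤ M / ρ ^ j) : ‖c * z ^ j‖ ≤ M * (r / ρ) ^ j := calc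
  ‖c * z ^ j‖ = ‖c‖ * ‖z‖ ^ j := by rw [norm_mul, norm_pow]
  _ ≤ M / ρ ^ j * r ^ j := by
    have := (norm_nonneg c).trans hc
    gcongr
  _ = M * (r / ρ) ^ j := by rw [div_pow]; ring

theorem summable_mul_geometric_div {r ρ : ℝ} (hr : 0 ≤ r) (hρ : r < ρ) (M : ℝ) :
    Summable fun j : ℕ => M * (r / ρ) ^ j :=
  (summable_geometric_of_lt_one (div_nonneg hr (hr.trans hρ.le))
    ((div_lt_one (hr.trans_lt hρ)).2 hρ)).mul_left M

theorem exists_tendsto_hyperfilter_of_norm_le {c : ℕ → ℂ} {M : ℝ} (hc : ∀ m, ‖c m‖ ≤ M) :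
    ∃ y, Tendsto c (hyperfilter ℕ) (𝓝 y) := by
  obtain ⟨y, -, hy⟩ := isCompact_iff_ultrafilter_le_nhds.1 (isCompact_closedBall (0 : ℂ) M)
    ((hyperfilter ℕ).map c) (tendsto_principal.2 (.of_forall fun m => by simpa using hc m))
  exact ⟨y, hy⟩

theorem analyticAt_tsum_mul_pow {e : ℕ → ℂ} {M ρ : ℝ} {z : ℂ} (hz : ‖z‖ < ρ)
    (he : ∀ j, ‖e j‖ ≤ M / ρ ^ j) : AnalyticAt ℂ (fun w => ∑' j, e j * w ^ j) z := by
  obtain ⟨r, hzr, hrρ⟩ := exists_between hz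
  have hr : 0 < r := (norm_nonneg z).trans_lt hzr
  refine (Complex.differentiableOn_tsum_of_summable_norm (summable_mul_geometric_div hr.le hrρ M)
    (fun j => by fun_prop) Metric.isOpen_ball fun j w hw => ?_).analyticAt
    (Metric.isOpen_ball.mem_nhds (mem_ball_zero_iff.2 hzr))
  exact norm_mul_pow_le_geometric (mem_ball_zero_iff.1 hw).le (he j)

theorem tendsto_of_tendsto_taylorCoeff {F : ℕ → ℂ → ℂ} {l : Filter ℕ} {e : ℕ → ℂ} {M ρ : ℝ} {z : ℂ}
    (hz : ‖z‖ < ρ) (hF : ∀ m, DifferentiableOn ℂ (F m) (Metric.closedBall 0 ρ))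
    (hM : ∀ m, ∀ w ∈ Metric.closedBall 0 ρ, ‖F m w‖ ≤ M)
    (he : ∀ j, Tendsto (fun m => (j ! : ℂ)⁻¹ * iteratedDeriv j (F m) 0) l (𝓝 (e j))) :
    Tendsto (fun m => F m z) l (𝓝 (∑' j, e j * z ^ j)) := by
  have hρ : 0 < ρ := (norm_nonneg z).trans_lt hz
  have hseries (m : ℕ) : ∑' j, (j ! : ℂ)⁻¹ * iteratedDeriv j (F m) 0 * z ^ j = F m z := by
    simpa only [sub_zero] using Complex.taylorSeries_eq_on_ball' (c := 0) (mem_ball_zero_iff.2 hz)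
      ((hF m).mono Metric.ball_subset_closedBall)
  simp only [← hseries]
  exact tendsto_tsum_of_dominated_convergence (summable_mul_geometric_div (norm_nonneg z) hz M)
    (fun j => (he j).mul_const _) (.of_forall fun m j =>
      norm_mul_pow_le_geometric le_rfl (norm_taylorCoeff_le hρ (hF m) (hM m) j))

-- `G` is the power series whose coefficients are the limits, along a fixed ultrafilter, of the
-- Taylor coefficients of `F m`.
theorem exists_analyticOnNhd_of_bounded {D : Set ℂ}
    (hD : ∀ z ∈ D, ∃ ρ, ‖z‖ < ρ ∧ Metric.closedBall 0 ρ ⊆ D) {F : ℕ → ℂ → ℂ}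
    (hF : ∀ m, AnalyticOnNhd ℂ (F m) D)
    (hM : ∀ ρ, Metric.closedBall 0 ρ ⊆ D → ∃ M, ∀ m, ∀ z ∈ Metric.closedBall 0 ρ, ‖F m z‖ ≤ M) :
    ∃ G : ℂ → ℂ, AnalyticOnNhd ℂ G D ∧
      ∀ z ∈ D, ∀ y, Tendsto (fun m => F m z) atTop (𝓝 y) → G z = y := by
  rcases D.eq_empty_or_nonempty with rfl | ⟨z₀, hz₀⟩
  · exact ⟨0, by simp [AnalyticOnNhd], by simp⟩
  have hdiff {ρ : ℝ} (hρD : Metric.closedBall 0 ρ ⊆ D) (m : ℕ) :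
      DifferentiableOn ℂ (F m) (Metric.closedBall 0 ρ) := ((hF m).mono hρD).differentiableOn
  have hlim (j : ℕ) : ∃ y,
      Tendsto (fun m => (j ! : ℂ)⁻¹ * iteratedDeriv j (F m) 0) (hyperfilter ℕ) (𝓝 y) := by
    obtain ⟨ρ, hρ, hρD⟩ := hD z₀ hz₀
    obtain ⟨M, hM⟩ := hM ρ hρD
    exact exists_tendsto_hyperfilter_of_norm_le fun m =>
      norm_taylorCoeff_le ((norm_nonneg _).trans_lt hρ) (hdiff hρD m) (hM m) j
  choose e he using hlim
  refine ⟨fun z => ∑' j, e j * z ^ j, fun z hz => ?_, fun z hz y hy => ?_⟩ <;>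
    obtain ⟨ρ, hρ, hρD⟩ := hD z hz <;> obtain ⟨M, hM⟩ := hM ρ hρD
  · exact analyticAt_tsum_mul_pow hρ fun j => le_of_tendsto (he j).norm (.of_forall fun m =>
      norm_taylorCoeff_le ((norm_nonneg z).trans_lt hρ) (hdiff hρD m) (hM m) j)
  · exact tendsto_nhds_unique (tendsto_of_tendsto_taylorCoeff hρ (hdiff hρD) hM he)
      (hy.mono_left Nat.hyperfilter_le_atTop)

end BoundedSequence

section FreeEnergy

/-- The free energy `-|Λ|⁻¹ log Z_Λ`, with the cluster expansion as the logarithm; it is `0` for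
`Λ = ∅`, where `|Λ|⁻¹ = 0`. -/
noncomputable def freeEnergy {d N : ℕ} (Φ : Interaction d N) (Λ : Finset (Site d)) (β : ℂ) : ℂ :=
  -(Λ.card : ℂ)⁻¹ * clusterSum Φ Λ β

variable {d N : ℕ} {Λ : Finset (Site d)} {Φ : Interaction d N} {β : ℂ} {a r : ℝ≥0}

theorem exists_gt_mul_lt {x s b : ℝ≥0} (h : x * s < b) : ∃ y, x < y ∧ y * s < b :=
  (eventually_mem_nhdsWithin.and
    ((((continuous_mul_const s).tendsto x).eventually_lt_const h).filter_mono
      nhdsWithin_le_nhds)).exists (f := 𝓝[>] x)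

theorem norm_weight_le_of_norm_le {β' : ℂ} (h : ‖β‖ ≤ ‖β'‖) (C : Cluster Λ) :
    ‖weight Φ β C‖ ≤ ‖weight Φ β' C‖ := by
  simp only [weight, norm_mul, norm_div, norm_pow, norm_neg]
  gcongr

theorem norm_clusterTerm_le_of_norm_le {β' : ℂ} (h : ‖β‖ ≤ ‖β'‖) {k : ℕ}
    (C : Fin k → Cluster Λ) : ‖clusterTerm Φ β C‖ ≤ ‖clusterTerm Φ β' C‖ := by
  simp only [clusterTerm, norm_mul, norm_prod]
  gcongr with i
  exact norm_weight_le_of_norm_le h _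

theorem clusterSum_zero : clusterSum Φ Λ 0 = 0 := by
  refine (tsum_congr fun p => ?_).trans tsum_zero
  have hn : (p.2 0).n ≠ 0 := fun h => by
    have := (p.2 0).connected.nonempty
    rw [h] at this
    exact isEmptyElim this.some
  rw [clusterTerm, Finset.prod_eq_zero (Finset.mem_univ 0), mul_zero, mul_zero]
  rw [weight, neg_zero, zero_pow hn, zero_div, zero_mul]

theorem freeEnergy_zero : freeEnergy Φ Λ 0 = 0 := by
  rw [freeEnergy, clusterSum_zero, mul_zero]

theorem mul_localNorm_le (hr : Real.exp a = r)
    (h : ‖β‖ₑ * interactionNorm Φ (Real.exp a * (1 + a)) ≤ ENNReal.ofReal a) :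
    ‖β‖₊ * localNorm Φ Λ (r * (1 + a)) ≤ a := by
  rw [hr, ENNReal.ofReal_coe_nnreal, enorm_eq_nnnorm] at h
  have := (mul_le_mul_right (localNorm_le_interactionNorm Φ Λ (r * (1 + a))) (‖β‖₊ : ℝ≥0∞)).trans h
  exact_mod_cast this

theorem mul_localNorm_lt (hr : Real.exp a = r) (h : β ∈ highTempDisc Φ a) :
    ‖β‖₊ * localNorm Φ Λ (r * (1 + a)) < a := by
  rw [highTempDisc, Set.mem_ofPred_eq, hr, ENNReal.ofReal_coe_nnreal, enorm_eq_nnnorm] at h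
  have := (mul_le_mul_right (localNorm_le_interactionNorm Φ Λ (r * (1 + a)))
    (‖β‖₊ : ℝ≥0∞)).trans_lt h
  exact_mod_cast this

theorem exists_closedBall_subset_highTempDisc
    (hΦ : interactionNorm Φ (Real.exp a * (1 + a)) ≠ ∞) (hβ : β ∈ highTempDisc Φ a) :
    ∃ ρ, ‖β‖ < ρ ∧ Metric.closedBall 0 ρ ⊆ highTempDisc Φ a := by
  lift interactionNorm Φ (Real.exp a * (1 + a)) to ℝ≥0 using hΦ with s hs
  have hmem (z : ℂ) : z ∈ highTempDisc Φ a ↔ ‖z‖₊ * s < a := by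
    rw [highTempDisc, Set.mem_ofPred_eq, ← hs, ENNReal.ofReal_coe_nnreal, enorm_eq_nnnorm]
    exact_mod_cast Iff.rfl
  obtain ⟨ρ, hβρ, hρ⟩ := exists_gt_mul_lt ((hmem β).1 hβ)
  refine ⟨ρ, hβρ, fun z hz => (hmem z).2 (lt_of_le_of_lt ?_ hρ)⟩
  gcongr
  exact mem_closedBall_zero_iff.1 hz

theorem highTempDisc_subset_of_eq_top (hΦ : interactionNorm Φ (Real.exp a * (1 + a)) = ∞) :
    highTempDisc Φ a ⊆ {0} := by
  intro β hβ
  by_contra h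
  rw [highTempDisc, Set.mem_ofPred_eq, hΦ, ENNReal.mul_top (enorm_ne_zero.2 h)] at hβ
  exact not_top_lt hβ

variable [NeZero N]

theorem analyticAt_clusterSum (hr : Real.exp a ≤ r)
    (h : ‖β‖₊ * localNorm Φ Λ (r * (1 + a)) < a) : AnalyticAt ℂ (clusterSum Φ Λ) β := by
  obtain ⟨ρ, hβρ, hρ⟩ := exists_gt_mul_lt h
  have hnorm : ‖((ρ : ℝ) : ℂ)‖₊ = ρ := by ext; simp
  have hs := summable_nnnorm_clusterTerm (β := ((ρ : ℝ) : ℂ)) hr (hnorm.symm ▸ hρ.le)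
  refine (Complex.differentiableOn_tsum_of_summable_norm (NNReal.summable_coe.2 hs) (fun p => ?_)
    Metric.isOpen_ball fun p w hw => ?_).analyticAt
    (Metric.isOpen_ball.mem_nhds (mem_ball_zero_iff.2 hβρ))
  · unfold clusterTerm weight
    fun_prop
  · rw [coe_nnnorm, norm_mul, norm_mul]
    gcongr
    exact norm_clusterTerm_le_of_norm_le ((mem_ball_zero_iff.1 hw).le.trans_eq (by simp)) _

variable (Φ Λ) in
theorem analyticOnNhd_freeEnergy : AnalyticOnNhd ℂ (freeEnergy Φ Λ) (highTempDisc Φ a) :=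
  fun _ hβ => analyticAt_const.mul <|
    analyticAt_clusterSum (r := ⟨Real.exp a, (Real.exp_pos _).le⟩) le_rfl (mul_localNorm_lt rfl hβ)

theorem partitionFunction_eq_exp_freeEnergy (hΛ : Λ.Nonempty) (hβ : β ∈ highTempDisc Φ a) :
    partitionFunction Φ Λ β = Complex.exp (-(Λ.card : ℂ) * freeEnergy Φ Λ β) := by
  have hcard : (Λ.card : ℂ) ≠ 0 := Nat.cast_ne_zero.2 hΛ.card_pos.ne'
  rw [freeEnergy, ← mul_assoc, neg_mul_neg, mul_inv_cancel₀ hcard, one_mul]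
  exact partitionFunction_eq_exp_clusterSum (r := ⟨Real.exp a, (Real.exp_pos _).le⟩) le_rfl
    (mul_localNorm_lt rfl hβ).le

open scoped Matrix.Norms.L2Operator in
theorem norm_freeEnergy_le (hβ : β ∈ highTempDisc Φ a) :
    ‖freeEnergy Φ Λ β‖ ≤ ‖β‖ * ‖Φ ∅‖ + a := by
  rw [freeEnergy, norm_mul, norm_neg, norm_inv, Complex.norm_natCast]
  rcases Λ.eq_empty_or_nonempty with rfl | hΛ
  · simp only [Finset.card_empty, Nat.cast_zero, inv_zero, zero_mul]
    positivity
  have hcard : (1 : ℝ) ≤ Λ.card := mod_cast hΛ.card_pos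
  rw [inv_mul_le_iff₀ (by positivity), mul_add]
  refine (norm_clusterSum_le (r := ⟨Real.exp a, (Real.exp_pos _).le⟩) le_rfl
    (mul_localNorm_lt rfl hβ).le).trans (add_le_add_left ?_ _)
  exact le_mul_of_one_le_left (by positivity) hcard

variable (Φ a) in
theorem exists_limit_freeEnergy (Λ : ℕ → Finset (Site d)) :
    ∃ G : ℂ → ℂ, AnalyticOnNhd ℂ G (highTempDisc Φ a) ∧ ∀ z ∈ highTempDisc Φ a, ∀ y,
      Tendsto (fun m => freeEnergy Φ (Λ m) z) atTop (𝓝 y) → G z = y := by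
  by_cases hΦ : interactionNorm Φ (Real.exp a * (1 + a)) = ∞
  · refine ⟨fun _ => 0, analyticOnNhd_const, fun z hz y hy => tendsto_nhds_unique ?_ hy⟩
    obtain rfl : z = 0 := highTempDisc_subset_of_eq_top hΦ hz
    simpa only [freeEnergy_zero] using tendsto_const_nhds
  open scoped Matrix.Norms.L2Operator in
  refine exists_analyticOnNhd_of_bounded
    (fun z hz => exists_closedBall_subset_highTempDisc hΦ hz)
    (fun m => analyticOnNhd_freeEnergy (Λ m) Φ) fun ρ hρ =>
      ⟨ρ * ‖Φ ∅‖ + a, fun m z hz => (norm_freeEnergy_le (hρ hz)).trans ?_⟩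
  gcongr
  exact mem_closedBall_zero_iff.1 hz

end FreeEnergy

end ClusterExpansion

open QLattice ClusterExpansion in
theorem theorem3p1_general {d N : ℕ} (hN : 1 ≤ N) (Φ : Interaction d N) (a : ℝ) (ha : 0 ≤ a) :
    (∀ β : ℂ, ‖β‖ₑ * interactionNorm Φ (Real.exp a * (1 + a)) ≤ ENNReal.ofReal a →
      ∀ Λ : Finset (Site d),
        Summable (fun p : Σ k : ℕ, (Fin (k + 1) → Cluster Λ) =>
          ‖1 / ((p.1 + 1)! : ℂ) * clusterTerm Φ β p.2‖) ∧
        partitionFunction Φ Λ β =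
          Complex.exp (∑' k : ℕ, 1 / ((k + 1)! : ℂ) *
            ∑' C : Fin (k + 1) → Cluster Λ, clusterTerm Φ β C) ∧
        ∀ C₁ : Cluster Λ,
          1 + ∑' k : ℕ, ((k + 2 : ℕ) : ℝ≥0∞) / ((k + 2)! : ℝ≥0∞) *
              ∑' C : Fin (k + 1) → Cluster Λ,
                ‖(phi (Fin.cons C₁ C : Fin (k + 2) → Cluster Λ) : ℂ)‖ₑ *
                  ∏ i, ‖weight Φ β (C i)‖ₑ
            ≤ ENNReal.ofReal (Real.exp (a * (C₁.supp.card : ℝ)))) ∧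
    (∀ Λ : Finset (Site d), Λ.Nonempty →
      AnalyticOnNhd ℂ (freeEnergy Φ Λ) (highTempDisc Φ a) ∧ freeEnergy Φ Λ 0 = 0 ∧
      ∀ β ∈ highTempDisc Φ a,
        partitionFunction Φ Λ β = Complex.exp (-(Λ.card : ℂ) * freeEnergy Φ Λ β)) ∧
    ∀ Λ : ℕ → Finset (Site d), ∃ G : ℂ → ℂ, AnalyticOnNhd ℂ G (highTempDisc Φ a) ∧
      ∀ β ∈ highTempDisc Φ a, ∀ y,
        Tendsto (fun m => freeEnergy Φ (Λ m) β) atTop (𝓝 y) → G β = y := by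
  have : NeZero N := ⟨by omega⟩
  lift a to ℝ≥0 using ha
  let r : ℝ≥0 := ⟨Real.exp a, (Real.exp_pos _).le⟩
  refine ⟨fun β h Λ => ?_, fun Λ hΛ => ⟨analyticOnNhd_freeEnergy Λ Φ, freeEnergy_zero,
    fun β => partitionFunction_eq_exp_freeEnergy hΛ⟩, exists_limit_freeEnergy Φ a⟩
  have hr : Real.exp a ≤ r := le_rfl
  have hlocal : ‖β‖₊ * localNorm Φ Λ (r * (1 + a)) ≤ a := mul_localNorm_le rfl h
  refine ⟨NNReal.summable_coe.2 (summable_nnnorm_clusterTerm hr hlocal), ?_, fun C₁ => ?_⟩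
  · rw [partitionFunction_eq_exp_clusterSum hr hlocal, clusterSum_eq hr hlocal]
  · refine (tsum_rooted_clusters_le hr hlocal C₁).trans_eq ?_
    rw [mul_comm (a : ℝ), Real.exp_nat_mul, ← ENNReal.ofReal_coe_nnreal, NNReal.coe_pow]
    rfl

open QLattice in
theorem theorem3p1 {d N : ℕ} (hN : 1 ≤ N) (Φ : Interaction d N) (a : ℝ) (ha : 0 < a) :
    (∀ β : ℂ, ‖β‖ₑ * interactionNorm Φ (Real.exp a * (1 + a)) ≤ ENNReal.ofReal a →
      ∀ Λ : Finset (Site d),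
        -- the sums in the cluster expansion are absolutely convergent
        Summable (fun p : Σ k : ℕ, (Fin (k + 1) → Cluster Λ) =>
          ‖1 / ((p.1 + 1)! : ℂ) * clusterTerm Φ β p.2‖) ∧
        -- the cluster expansion of the partition function (the sum over `k ≥ 1` is shifted by one)
        partitionFunction Φ Λ β =
          Complex.exp (∑' k : ℕ, 1 / ((k + 1)! : ℂ) *
            ∑' C : Fin (k + 1) → Cluster Λ, clusterTerm Φ β C) ∧
        -- the bound with one cluster fixed (the sum over `k ≥ 2` is shifted by two)
        ∀ C₁ : Cluster Λ,
          1 + ∑' k : ℕ, ((k + 2 : ℕ) : ℝ≥0∞) / ((k + 2)! : ℝ≥0∞) *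
              ∑' C : Fin (k + 1) → Cluster Λ,
                ‖(phi (Fin.cons C₁ C : Fin (k + 2) → Cluster Λ) : ℂ)‖ₑ *
                  ∏ i, ‖weight Φ β (C i)‖ₑ
            ≤ ENNReal.ofReal (Real.exp (a * (C₁.supp.card : ℝ)))) ∧
    -- analyticity of the free energy, in finite volume and in the infinite-volume limit
    ∃ f : Finset (Site d) → ℂ → ℂ,
      (∀ Λ : Finset (Site d), Λ.Nonempty →
        AnalyticOnNhd ℂ (f Λ) (highTempDisc Φ a) ∧ f Λ 0 = 0 ∧
        ∀ β ∈ highTempDisc Φ a,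
          partitionFunction Φ Λ β = Complex.exp (-(Λ.card : ℂ) * f Λ β)) ∧
      ∀ (Λ : ℕ → Finset (Site d)) (g : ℝ → ℂ), Tendsto Λ atTop atTop →
        (∀ t : ℝ, 0 ≤ t → (t : ℂ) ∈ highTempDisc Φ a →
          Tendsto (fun m => f (Λ m) t) atTop (𝓝 (g t))) →
        ∃ G : ℂ → ℂ, AnalyticOnNhd ℂ G (highTempDisc Φ a) ∧
          ∀ t : ℝ, 0 ≤ t → (t : ℂ) ∈ highTempDisc Φ a → G t = g t := by
  obtain ⟨hexpansion, hfree, hlimit⟩ := theorem3p1_general hN Φ a ha.le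
  refine ⟨hexpansion, ClusterExpansion.freeEnergy Φ, hfree, fun Λ g _ hg => ?_⟩
  obtain ⟨G, hG, hGlim⟩ := hlimit Λ
  exact ⟨G, hG, fun t ht htD => hGlim t htD (g t) (hg t ht htD)⟩
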